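/- Conventions. Let $n\ge 2$, let $M$ be a smooth $n$-manifold without boundary, and let $F:M\to\mathbb{R}^{n+1}$ be a smooth embedding. $F$ is an embedding of a convex hypersurface if $F(M)=\partial\Omega$ for a nonempty open convex set $\Omega\subset\mathbb{R}^{n+1}$ (the convex interior of $F(M)$). Let $\nu$ be the outward unit normal, $g$ the induced metric, $h(X,Y)=\langle D_X\nu,\,dF(Y)\rangle$ the second fundamental form, $\lambda_1\le\dots\le\lambda_n$ the principal curvatures (the eigenvalues of $h$ with respect to $g$), $H=\lambda_1+\dots+\lambda_n$ the mean curvature, and $d_g$ the intrinsic distance of $M$. For $p\in M$, the inscribed radius at $p$ is the supremum of all $r\geq 0$ such that the open ball $B(F(p)-r\nu(p),r)$ is contained in $\Omega$. For $\alpha>0$, $M$ is $\alpha$-noncollapsed if $B\big(F(p)-\tfrac{\alpha}{H(p)}\nu(p),\tfrac{\alpha}{H(p)}\big)\subset\Omega$ for every $p\in M$. Theorem. Let $C_0>0$. (i) There exists $\alpha=\alpha(C_0)>0$, depending only on $C_0$ (not on $n$, $M$ or $F$), such that the following holds. Let $n\ge2$ and let $F:M\to\mathbb{R}^{n+1}$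 be an embedding of a closed, convex hypersurface such that $C_0^{-1}\le H\le C_0$ and $\lambda_1\ge C_0^{-1}H$ everywhere on $M$. Then $M$ is $\alpha$-noncollapsed. (ii) There exists $\alpha=\alpha(C_0)>0$, depending only on $C_0$, such that the following holds. Let $n\ge2$ and let $F:M\to\mathbb{R}^{n+1}$ be an embedding of a (possibly noncompact) complete, convex hypersurface. Let $D\subset M$ be an open set such that $C_0^{-1}\le H\le C_0$ and $\lambda_1\ge C_0^{-1}H$ everywhere on $D$. If $p\in D$ satisfies $d_g(p,\partial D)>\tfrac12C_0^{-1}$ (with $d_g(p,\emptyset)=\infty$), then the inscribed radius at $p$ is at least $\alpha/H(p)$. -/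

import Mathlib

open scoped Manifold ContDiff ENNReal NNReal Topology

namespace ConvexHypersurface

section Immersed

variable {n : ℕ} {M : Type*} [TopologicalSpace M] [ChartedSpace (EuclideanSpace ℝ (Fin n)) M]

/-- The differential at `p` of a map from an `n`-manifold to `ℝ^{n+1}`. The tangent space `T_p M` is
identified with `ℝ^n` by the preferred chart at `p`. -/
noncomputable def differential (F : M → EuclideanSpace ℝ (Fin (n + 1))) (p : M) :
    EuclideanSpace ℝ (Fin n) →L[ℝ] EuclideanSpace ℝ (Fin (n + 1)) :=
  mfderiv (𝓡 n) (𝓡 (n + 1)) F p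

/-- The induced metric `g_p(v, w) = ⟨dF v, dF w⟩`. -/
noncomputable def firstForm (F : M → EuclideanSpace ℝ (Fin (n + 1))) (p : M)
    (v w : EuclideanSpace ℝ (Fin n)) : ℝ :=
  inner ℝ (differential F p v) (differential F p w)

/-- The scalar second fundamental form `h_p(v, w) = ⟨A(v, w), -ν⟩ = ⟨D_v ν, dF w⟩` with respect to
the unit normal field `ν`; it is positive on round spheres when `ν` is the outward normal. -/
noncomputable def secondForm (F ν : M → EuclideanSpace ℝ (Fin (n + 1))) (p : M)
    (v w : EuclideanSpace ℝ (Fin n)) : ℝ :=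
  inner ℝ (differential ν p v) (differential F p w)

/-- The mean curvature `H = g^{ij} h_{ij}`, the trace of `h` with respect to `g`. -/
noncomputable def meanCurvature (F ν : M → EuclideanSpace ℝ (Fin (n + 1))) (p : M) : ℝ :=
  ((Matrix.of fun i j : Fin n =>
        firstForm F p (EuclideanSpace.single i 1) (EuclideanSpace.single j 1))⁻¹ *
    (Matrix.of fun i j : Fin n =>
        secondForm F ν p (EuclideanSpace.single i 1) (EuclideanSpace.single j 1))).trace

/-- The principal curvatures at `p`: the eigenvalues of `h` with respect to `g`. -/
def IsPrincipalCurvature (F ν : M → EuclideanSpace ℝ (Fin (n + 1))) (p : M) (κ : ℝ) : Prop :=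
  ∃ v : EuclideanSpace ℝ (Fin n), v ≠ 0 ∧
    ∀ w : EuclideanSpace ℝ (Fin n), secondForm F ν p v w = κ * firstForm F p v w

/-- The smallest principal curvature `λ₁`. -/
noncomputable def lambdaOne (F ν : M → EuclideanSpace ℝ (Fin (n + 1))) (p : M) : ℝ :=
  sInf {κ : ℝ | IsPrincipalCurvature F ν p κ}

/-- The intrinsic distance `d_g`: the infimum of the lengths, with respect to the induced metric, of
`C¹` paths from `p` to `q` in `M` (so `⊤` if there is no such path). -/
noncomputable def intrinsicDist (F : M → EuclideanSpace ℝ (Fin (n + 1))) (p q : M) : ℝ≥0∞ :=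
  letI : ∀ x : M, ENorm (TangentSpace (𝓡 n) x) := fun x => ⟨fun v => ‖differential F x v‖ₑ⟩
  Manifold.riemannianEDist (𝓡 n) p q

/-- Completeness of the induced metric: every sequence that is Cauchy for `d_g` converges. -/
def IsCompleteHypersurface (F : M → EuclideanSpace ℝ (Fin (n + 1))) : Prop :=
  ∀ u : ℕ → M,
    (∀ ε : ℝ≥0∞, 0 < ε → ∃ N : ℕ, ∀ k ≥ N, ∀ l ≥ N, intrinsicDist F (u k) (u l) < ε) →
    ∃ x : M, Filter.Tendsto u Filter.atTop (𝓝 x)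

/-- `F` is a smooth embedding of `M` as a convex hypersurface with convex interior `Ω`: its image is
the boundary of the open convex set `Ω`. -/
structure IsConvexEmbedding (F : M → EuclideanSpace ℝ (Fin (n + 1)))
    (Ω : Set (EuclideanSpace ℝ (Fin (n + 1)))) : Prop where
  isSmoothEmbedding : Manifold.IsSmoothEmbedding (𝓡 n) (𝓡 (n + 1)) ∞ F
  isOpen : IsOpen Ω
  nonempty : Ω.Nonempty
  convex : Convex ℝ Ω
  frontier_eq : frontier Ω = Set.range F

/-- `ν` is the outward pointing smooth unit normal field along `F`, where `F` parametrizes the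
boundary of the convex set `Ω`. -/
structure IsOutwardUnitNormal (F : M → EuclideanSpace ℝ (Fin (n + 1)))
    (Ω : Set (EuclideanSpace ℝ (Fin (n + 1)))) (ν : M → EuclideanSpace ℝ (Fin (n + 1))) :
    Prop where
  contMDiff : ContMDiff (𝓡 n) (𝓡 (n + 1)) ∞ ν
  norm_eq_one : ∀ p : M, ‖ν p‖ = 1
  normal : ∀ (p : M) (v : EuclideanSpace ℝ (Fin n)), inner ℝ (differential F p v) (ν p) = 0
  outward : ∀ p : M, ∀ᶠ t : ℝ in 𝓝[>] 0, F p + t • ν p ∉ closure Ω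

/-- `α`-noncollapsing: for every `p`, the open ball of radius `α / H(p)` inside the hypersurface
that touches it at `F p` is contained in `Ω`. -/
def IsNoncollapsed (F : M → EuclideanSpace ℝ (Fin (n + 1)))
    (Ω : Set (EuclideanSpace ℝ (Fin (n + 1)))) (ν : M → EuclideanSpace ℝ (Fin (n + 1)))
    (α : ℝ) : Prop :=
  ∀ p : M, Metric.ball (F p - (α / meanCurvature F ν p) • ν p) (α / meanCurvature F ν p) ⊆ Ω

/-- The inscribed radius at `p`: the supremum of the radii `r` of open balls that are contained in
`Ω` and touch its boundary at `F p`, that is, of the balls `B(F p - r ν(p), r) ⊆ Ω`. -/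
noncomputable def inscribedRadius (F : M → EuclideanSpace ℝ (Fin (n + 1)))
    (Ω : Set (EuclideanSpace ℝ (Fin (n + 1)))) (ν : M → EuclideanSpace ℝ (Fin (n + 1)))
    (p : M) : ℝ≥0∞ :=
  ⨆ (r : ℝ≥0) (_ : Metric.ball (F p - (r : ℝ) • ν p) (r : ℝ) ⊆ Ω), (r : ℝ≥0∞)

end Immersed

end ConvexHypersurface

/-!
The proof is the support function argument for Blaschke's rolling theorem, made local. Let `ν` be
the Gauss map. By convexity the tangent hyperplanes support `Ω` (`inner_sub_normal_neg`), so `q`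
maximizes the height `⟨F ·, ν q⟩`, and the ball of radius `r` touching at `F p` lies in `Ω` as
soon as `⟨F q - F p, ν q⟩ ≥ r (1 - ⟨ν p, ν q⟩)` for all `q` (`ball_subset_of_forall_inner_ge`).

On `D` all principal curvatures lie in `[C₀⁻², C₀]`: they are positive with sum `H ≤ C₀`
(`curvature_bounds`). So `ν` is a local diffeomorphism there, and a unit speed great circle `γ`
from `ν p` towards `ν q` lifts to a curve `c` of speed at most `C₀²`. Its length is at most
`C₀⁻¹ / 2` up to the time `C₀⁻³ / 2`, so until then it does not meet the frontier of `D`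
(`exists_isReached`). As `F` is an embedding with closed image `∂Ω`, the lift does not escape to
infinity either.

Let `T` be the angle between `ν p` and `ν q`. As `(F ∘ c)'` is tangent and
`⟨(F ∘ c)', γ'⟩ ≥ C₀⁻¹`, the height of `c` in the direction `ν q = γ(T)` grows at least at the
rate `C₀⁻¹ sin (T - t)`. Hence it is at least `C₀⁻¹ (cos (T - t) - cos T)` at time `t`, and the point `q`, which
maximizes this height, lies no lower. For `t` the smaller of `T` and a time depending only on
`C₀`, this is at least a fixed multiple of `1 - cos T = 1 - ⟨ν p, ν q⟩` (`rollingRadius_mul_le`),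
which is the criterion. The closed case is the case `D = M`.
-/

namespace ConvexHypersurface

/-! ### Differentials in charts and along curves -/

section Calculus

variable {n : ℕ} {M : Type*} [TopologicalSpace M] [ChartedSpace (EuclideanSpace ℝ (Fin n)) M]

/-- In the charts of the definition of an immersion, `F` is `x ↦ (x, 0)`, so it has a smooth local
left inverse. -/
theorem differential_injective [IsManifold (𝓡 n) ∞ M] {F : M → EuclideanSpace ℝ (Fin (n + 1))}
    (hF : Manifold.IsImmersion (𝓡 n) (𝓡 (n + 1)) ∞ F) (p : M) :
    Function.Injective (differential F p) := by
  have h := hF.isImmersionAt p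
  have hFd : MDifferentiableAt (𝓡 n) (𝓡 (n + 1)) F p :=
    (hF.contMDiff p).mdifferentiableAt (by simp)
  have hφ : ContMDiffAt (𝓡 n) (𝓡 n) ∞ h.domChart.symm (h.domChart p) :=
    (contMDiffOn_symm_of_mem_maximalAtlas h.domChart_mem_maximalAtlas).contMDiffAt
      (h.domChart.open_target.mem_nhds (h.domChart.map_source h.mem_domChart_source))
  have hψ : ContMDiffAt (𝓡 (n + 1)) (𝓡 (n + 1)) ∞ h.codChart (F p) :=
    (contMDiffOn_of_mem_maximalAtlas h.codChart_mem_maximalAtlas).contMDiffAt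
      (h.codChart.open_source.mem_nhds h.mem_codChart_source)
  set L : EuclideanSpace ℝ (Fin (n + 1)) →L[ℝ] EuclideanSpace ℝ (Fin n) :=
    (ContinuousLinearMap.fst ℝ (EuclideanSpace ℝ (Fin n)) h.complement).comp
      h.equiv.symm.toContinuousLinearMap with hL
  have hw : ∀ x ∈ h.domChart.source, L (h.codChart (F x)) = h.domChart x := by
    intro x hx
    have hx' : h.domChart x ∈ (h.domChart.extend (𝓡 n)).target := by
      simpa using h.domChart.map_source hx
    have := h.writtenInCharts hx'
    simp only [Function.comp_apply, OpenPartialHomeomorph.extend_coe_symm,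
      OpenPartialHomeomorph.extend_coe, modelWithCornersSelf_coe, modelWithCornersSelf_coe_symm,
      id_eq, h.domChart.left_inv hx] at this
    simp [hL, this]
  have hp := hw p h.mem_domChart_source
  have hLd : ContMDiffAt (𝓡 (n + 1)) (𝓡 n) ∞ L (h.codChart (F p)) :=
    L.contDiff.contMDiff.contMDiffAt
  have hG : ContMDiffAt (𝓡 (n + 1)) (𝓡 n) ∞ (h.domChart.symm ∘ L ∘ h.codChart) (F p) := by
    refine ContMDiffAt.comp (F p) ?_ (hLd.comp (F p) hψ)
    simpa [hp] using hφ
  have hGF : (h.domChart.symm ∘ L ∘ h.codChart) ∘ F =ᶠ[𝓝 p] id := by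
    filter_upwards [h.domChart.open_source.mem_nhds h.mem_domChart_source] with x hx
    simp [hw x hx, h.domChart.left_inv hx]
  have hd := hGF.mfderiv_eq (I := 𝓡 n) (I' := 𝓡 n)
  rw [mfderiv_comp p (hG.mdifferentiableAt (by simp)) hFd, mfderiv_id] at hd
  intro v w hvw
  have hv := congrArg (fun A => A v) hd
  have hw' := congrArg (fun A => A w) hd
  change mfderiv (𝓡 (n + 1)) (𝓡 n) _ (F p) (differential F p v) = v at hv
  change mfderiv (𝓡 (n + 1)) (𝓡 n) _ (F p) (differential F p w) = w at hw'
  rw [← hv, ← hw', hvw]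

theorem contDiffAt_comp_chart_symm [IsManifold (𝓡 n) ∞ M]
    {F : M → EuclideanSpace ℝ (Fin (n + 1))} (hF : ContMDiff (𝓡 n) (𝓡 (n + 1)) ∞ F) (q : M)
    {x : EuclideanSpace ℝ (Fin n)} (hx : x ∈ (chartAt (EuclideanSpace ℝ (Fin n)) q).target) :
    ContDiffAt ℝ ∞ (F ∘ (chartAt (EuclideanSpace ℝ (Fin n)) q).symm) x := by
  rw [← contMDiffAt_iff_contDiffAt]
  exact (hF _).comp x (contMDiffOn_chart_symm.contMDiffAt
    ((chartAt (EuclideanSpace ℝ (Fin n)) q).open_target.mem_nhds hx))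

/-- In the parametrization of `M` by the inverse of a preferred chart, the differentials of all
smooth maps are precomposed with one and the same invertible linear map. -/
theorem exists_fderiv_comp_chart_symm [IsManifold (𝓡 n) ∞ M] (q : M)
    {x : EuclideanSpace ℝ (Fin n)} (hx : x ∈ (chartAt (EuclideanSpace ℝ (Fin n)) q).target) :
    ∃ T : EuclideanSpace ℝ (Fin n) →L[ℝ] EuclideanSpace ℝ (Fin n), Function.Bijective T ∧
      ∀ G : M → EuclideanSpace ℝ (Fin (n + 1)), ContMDiff (𝓡 n) (𝓡 (n + 1)) ∞ G → ∀ v,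
        fderiv ℝ (G ∘ (chartAt (EuclideanSpace ℝ (Fin n)) q).symm) x v =
          differential G ((chartAt (EuclideanSpace ℝ (Fin n)) q).symm x) (T v) := by
  refine ⟨mfderiv (𝓡 n) (𝓡 n) (chartAt (EuclideanSpace ℝ (Fin n)) q).symm x,
    (mdifferentiable_chart (I := 𝓡 n) q).symm.mfderiv_bijective hx, fun G hG v => ?_⟩
  rw [← mfderiv_eq_fderiv, mfderiv_comp x ((hG _).mdifferentiableAt (by simp))
    (mdifferentiableAt_atlas_symm (chart_mem_atlas _ q) hx)]
  rfl

theorem hasDerivAt_comp_curve [IsManifold (𝓡 n) ∞ M]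
    {F : M → EuclideanSpace ℝ (Fin (n + 1))} (hF : ContMDiff (𝓡 n) (𝓡 (n + 1)) ∞ F) {c : ℝ → M}
    {s : ℝ} (hc : MDifferentiableAt 𝓘(ℝ, ℝ) (𝓡 n) c s) :
    HasDerivAt (F ∘ c) (differential F (c s) (mfderiv 𝓘(ℝ, ℝ) (𝓡 n) c s (1 : ℝ))) s := by
  have hFd := (hF (c s)).mdifferentiableAt (by simp)
  have h1 : MDifferentiableAt 𝓘(ℝ, ℝ) (𝓡 (n + 1)) (F ∘ c) s := hFd.comp s hc
  have h2 : DifferentiableAt ℝ (F ∘ c) s := mdifferentiableAt_iff_differentiableAt.1 h1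
  have h3 : differential F (c s) (mfderiv 𝓘(ℝ, ℝ) (𝓡 n) c s (1 : ℝ)) = deriv (F ∘ c) s := by
    rw [← fderiv_apply_one_eq_deriv, ← mfderiv_eq_fderiv, mfderiv_comp s hFd hc]
    rfl
  rw [h3]
  exact h2.hasDerivAt

end Calculus

/-! ### Tangent hyperplanes support the convex interior -/

theorem _root_.IsPreconnected.inter_frontier_nonempty_of_isOpen {X : Type*} [TopologicalSpace X]
    {t s : Set X} (ht : IsPreconnected t) (hs : IsOpen s) (h₁ : (t ∩ s).Nonempty)
    (h₂ : (t ∩ sᶜ).Nonempty) : (t ∩ frontier s).Nonempty := by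
  by_contra hcon
  have hout : ∀ x ∈ t, x ∉ s → x ∈ (closure s)ᶜ := fun x hx hxs hcl =>
    hcon ⟨x, hx, hs.frontier_eq ▸ ⟨hcl, hxs⟩⟩
  obtain ⟨y, hyt, hys⟩ := h₂
  obtain ⟨z, -, hz, hz'⟩ := ht s (closure s)ᶜ hs isClosed_closure.isOpen_compl
    (fun x hx => (em (x ∈ s)).imp id (hout x hx)) h₁ ⟨y, hyt, hout y hyt hys⟩
  exact hz' (subset_closure hz)

section Support

variable {n : ℕ} {M : Type*} [TopologicalSpace M] [ChartedSpace (EuclideanSpace ℝ (Fin n)) M]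
  {F ν : M → EuclideanSpace ℝ (Fin (n + 1))} {Ω : Set (EuclideanSpace ℝ (Fin (n + 1)))}

theorem inner_differential_eq_zero_of_isMax [IsManifold (𝓡 n) ∞ M]
    (hF : ContMDiff (𝓡 n) (𝓡 (n + 1)) ∞ F) {p : M} {w : EuclideanSpace ℝ (Fin (n + 1))}
    (hmax : ∀ q, inner ℝ (F q) w ≤ inner ℝ (F p) w) (v : EuclideanSpace ℝ (Fin n)) :
    inner ℝ (differential F p v) w = 0 := by
  set φ := chartAt (EuclideanSpace ℝ (Fin n)) p with hφ
  have hx : φ p ∈ φ.target := φ.map_source (mem_chart_source _ p)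
  have hσ : φ.symm (φ p) = p := φ.left_inv (mem_chart_source _ p)
  have hf := (contDiffAt_comp_chart_symm hF p hx).differentiableAt (by simp)
  have hloc : IsLocalMax (fun x => inner ℝ ((F ∘ φ.symm) x) w) (φ p) :=
    Filter.Eventually.of_forall fun x => by simpa [hσ] using hmax _
  have h0 := hloc.fderiv_eq_zero
  obtain ⟨T, hT, hTF⟩ := exists_fderiv_comp_chart_symm p hx
  obtain ⟨u, rfl⟩ := hT.surjective v
  have h1 : fderiv ℝ (fun x => inner ℝ ((F ∘ φ.symm) x) w) (φ p) u = 0 := by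
    rw [h0]; rfl
  rw [fderiv_inner_apply ℝ hf (differentiableAt_const w), hTF F hF, hσ] at h1
  simpa using h1

/-- The orthogonal complement of the range of an injective linear map `ℝ^n → ℝ^{n+1}` is a line. -/
theorem exists_eq_smul_of_orthogonal
    {A : EuclideanSpace ℝ (Fin n) →L[ℝ] EuclideanSpace ℝ (Fin (n + 1))}
    (hA : Function.Injective A) {u w : EuclideanSpace ℝ (Fin (n + 1))} (hu : u ≠ 0)
    (hAu : ∀ v, inner ℝ (A v) u = 0) (hAw : ∀ v, inner ℝ (A v) w = 0) : ∃ μ : ℝ, μ • u = w := by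
  set R := LinearMap.range A.toLinearMap with hR
  have hfin : Module.finrank ℝ R = n := by
    rw [LinearMap.finrank_range_of_inj hA]; simp
  have h1 : Module.finrank ℝ Rᗮ = 1 := by
    have := R.finrank_add_finrank_orthogonal
    rw [hfin] at this
    simp at this
    omega
  have mem : ∀ x, (∀ v, inner ℝ (A v) x = 0) → x ∈ Rᗮ := by
    intro x hx
    rw [Submodule.mem_orthogonal]
    rintro _ ⟨v, rfl⟩
    exact hx v
  obtain ⟨μ, hμ⟩ := (finrank_eq_one_iff_of_nonzero' (⟨u, mem u hAu⟩ : Rᗮ)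
    (by simpa [Subtype.ext_iff] using hu)).1 h1 ⟨w, mem w hAw⟩
  exact ⟨μ, by simpa [Subtype.ext_iff] using hμ⟩

/-- The tangent hyperplane at `F p` supports `Ω` on the side determined by the outward normal. A
hyperplane that separates `Ω` from the outward normal ray at `F p` supports `Ω` at `F p`, hence is
the tangent hyperplane, and the ray fixes its orientation. -/
theorem inner_sub_normal_neg [IsManifold (𝓡 n) ∞ M] (hF : IsConvexEmbedding F Ω)
    (hν : IsOutwardUnitNormal F Ω ν) (p : M) {x : EuclideanSpace ℝ (Fin (n + 1))} (hx : x ∈ Ω) :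
    inner ℝ (x - F p) (ν p) < 0 := by
  have hcl : ∀ q, F q ∈ closure Ω := fun q =>
    frontier_subset_closure (hF.frontier_eq ▸ Set.mem_range_self q)
  obtain ⟨ε, hε, hout⟩ := (nhdsGT_basis (0 : ℝ)).eventually_iff.1 (hν.outward p)
  set S : Set (EuclideanSpace ℝ (Fin (n + 1))) := (fun t : ℝ => F p + t • ν p) '' Set.Ioo 0 ε
  have hS : Convex ℝ S := by
    have : S = AffineMap.lineMap (F p) (F p + ν p) '' Set.Ioo (0 : ℝ) ε := by
      refine Set.image_congr fun t _ => ?_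
      simp [AffineMap.lineMap_apply, add_comm]
    rw [this]
    exact (convex_Ioo 0 ε).affine_image _
  have hdisj : Disjoint Ω S := by
    rw [Set.disjoint_left]
    rintro y hy ⟨t, ht, rfl⟩
    exact hout ht (subset_closure hy)
  obtain ⟨f, u, hfu, huS⟩ := geometric_hahn_banach_open hF.convex hF.isOpen hS hdisj
  set w := (InnerProductSpace.toDual ℝ (EuclideanSpace ℝ (Fin (n + 1)))).symm f with hw
  have hfw : ∀ y, f y = inner ℝ y w := by
    intro y
    rw [real_inner_comm, hw, InnerProductSpace.toDual_symm_apply]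
  have hle : ∀ y ∈ closure Ω, f y ≤ u := by
    intro y hy
    exact closure_minimal (fun z hz => (hfu z hz).le)
      (isClosed_le f.continuous continuous_const) hy
  have hray : ∀ t ∈ Set.Ioo (0 : ℝ) ε, u ≤ f (F p) + t * f (ν p) := by
    intro t ht
    simpa using huS _ ⟨t, ht, rfl⟩
  have hFp : f (F p) = u := by
    refine le_antisymm (hle _ (hcl p)) ?_
    have hc : Filter.Tendsto (fun t : ℝ => f (F p) + t * f (ν p)) (𝓝[>] 0)
        (𝓝 (f (F p) + 0 * f (ν p))) :=
      ((continuous_const.add (continuous_id.mul continuous_const)).tendsto 0).mono_left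
        nhdsWithin_le_nhds
    rw [zero_mul, add_zero] at hc
    exact ge_of_tendsto hc (Filter.eventually_of_mem (Ioo_mem_nhdsGT hε) hray)
  have hν0 : ν p ≠ 0 := by
    intro h; have := hν.norm_eq_one p; simp [h] at this
  obtain ⟨μ, hμ⟩ := exists_eq_smul_of_orthogonal
    (differential_injective hF.isSmoothEmbedding.isImmersion p) hν0 (hν.normal p)
    (inner_differential_eq_zero_of_isMax hF.isSmoothEmbedding.contMDiff (w := w)
      (fun q => by rw [← hfw, ← hfw, hFp]; exact hle _ (hcl q)))
  have hμ0 : 0 ≤ μ := by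
    have h1 := hray (ε / 2) ⟨half_pos hε, half_lt_self hε⟩
    rw [hFp, hfw, ← hμ, inner_smul_right, real_inner_self_eq_norm_sq, hν.norm_eq_one p] at h1
    nlinarith [half_pos hε]
  have h2 := hfu x hx
  rw [← hFp, ← sub_neg, ← map_sub, hfw, ← hμ, inner_smul_right] at h2
  by_contra hcon
  exact absurd h2 (not_lt.2 (mul_nonneg hμ0 (not_lt.1 hcon)))

theorem inner_sub_normal_nonpos [IsManifold (𝓡 n) ∞ M] (hF : IsConvexEmbedding F Ω)
    (hν : IsOutwardUnitNormal F Ω ν) (p q : M) : inner ℝ (F q - F p) (ν p) ≤ 0 := by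
  have hq : F q ∈ closure Ω := frontier_subset_closure (hF.frontier_eq ▸ Set.mem_range_self q)
  refine closure_minimal (t := {x | inner ℝ (x - F p) (ν p) ≤ 0})
    (fun x hx => (inner_sub_normal_neg hF hν p hx).le) ?_ hq
  exact isClosed_le (by fun_prop) continuous_const

/-- `Ω` is the intersection of the open half-spaces bounded by its tangent hyperplanes: a segment
from a point of `Ω` to a point outside `Ω` crosses the tangent hyperplane at a frontier point. -/
theorem mem_of_forall_inner_sub_normal_neg [IsManifold (𝓡 n) ∞ M] (hF : IsConvexEmbedding F Ω)
    (hν : IsOutwardUnitNormal F Ω ν) {x : EuclideanSpace ℝ (Fin (n + 1))}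
    (hx : ∀ q, inner ℝ (x - F q) (ν q) < 0) : x ∈ Ω := by
  by_contra hxΩ
  obtain ⟨x₀, hx₀⟩ := hF.nonempty
  obtain ⟨y, hy, hyΩ⟩ : ((segment ℝ x₀ x) ∩ frontier Ω).Nonempty := by
    refine (convex_segment x₀ x).isPreconnected.inter_frontier_nonempty_of_isOpen hF.isOpen ?_ ?_
    · exact ⟨x₀, left_mem_segment ℝ _ _, hx₀⟩
    · exact ⟨x, right_mem_segment ℝ _ _, hxΩ⟩
  rw [hF.frontier_eq] at hyΩ
  obtain ⟨q, rfl⟩ := hyΩ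
  obtain ⟨a, b, ha, hb, hab, h⟩ := hy
  have h0 : a * inner ℝ (x₀ - F q) (ν q) + b * inner ℝ (x - F q) (ν q) = 0 := by
    rw [← real_inner_smul_left, ← real_inner_smul_left, ← inner_add_left, smul_sub, smul_sub,
      sub_add_sub_comm, h, ← add_smul, hab, one_smul, sub_self, inner_zero_left]
  have h1 := inner_sub_normal_neg hF hν q hx₀
  have h2 := hx q
  rcases ha.eq_or_lt with rfl | ha
  · rw [zero_add] at hab; subst hab; linarith
  · nlinarith

/-- The rolling criterion in terms of the Gauss map: the ball of radius `r` that touches the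
hypersurface at `F p` lies in `Ω` as soon as its support function is at most that of `Ω` in every
direction `ν q`. -/
theorem ball_subset_of_forall_inner_ge [IsManifold (𝓡 n) ∞ M] (hF : IsConvexEmbedding F Ω)
    (hν : IsOutwardUnitNormal F Ω ν) {p : M} {r : ℝ}
    (h : ∀ q, r * (1 - inner ℝ (ν p) (ν q)) ≤ inner ℝ (F q - F p) (ν q)) :
    Metric.ball (F p - r • ν p) r ⊆ Ω := by
  intro x hx
  refine mem_of_forall_inner_sub_normal_neg hF hν fun q => ?_
  rw [Metric.mem_ball, dist_eq_norm] at hx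
  have h1 : x - F q = (x - (F p - r • ν p)) - (F q - F p) - r • ν p := by abel
  have h2 := real_inner_le_norm (x - (F p - r • ν p)) (ν q)
  rw [hν.norm_eq_one, mul_one] at h2
  rw [h1, inner_sub_left, inner_sub_left, inner_smul_left]
  simp only [conj_trivial]
  linarith [h q]

end Support

/-! ### The Weingarten map -/

section Curvature

/-- If the eigenvalues of a symmetric operator are nonnegative, each of them is at most the trace.
In an orthonormal eigenbasis this bounds `S` from above, and the least eigenvalue from below. -/
theorem _root_.LinearMap.IsSymmetric.inner_bounds {V : Type*} [NormedAddCommGroup V]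
    [InnerProductSpace ℝ V] [FiniteDimensional ℝ V] {S : V →ₗ[ℝ] V} (hS : S.IsSymmetric)
    {c C : ℝ} (hc : 0 ≤ c) (hev : ∀ κ, Module.End.HasEigenvalue S κ → c ≤ κ)
    (htr : LinearMap.trace ℝ V S ≤ C) (x : V) :
    c * ‖x‖ ^ 2 ≤ inner ℝ (S x) x ∧ ‖S x‖ ^ 2 ≤ C * inner ℝ (S x) x := by
  set b := hS.eigenvectorBasis rfl with hb
  set l := hS.eigenvalues rfl with hl
  have hcl : ∀ i, c ≤ l i := fun i => hev _ (hS.hasEigenvalue_eigenvalues rfl i)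
  have hlC : ∀ i, l i ≤ C := by
    intro i
    refine le_trans ?_ htr
    rw [hS.trace_eq_sum_eigenvalues rfl]
    exact Finset.single_le_sum (f := l) (fun j _ => hc.trans (hcl j)) (Finset.mem_univ i)
  have hSb : ∀ i, inner ℝ (S x) (b i) = l i * inner ℝ x (b i) := by
    intro i
    rw [hS x (b i), hb, hS.apply_eigenvectorBasis, inner_smul_right]
    rfl
  have h1 : inner ℝ (S x) x = ∑ i, l i * inner ℝ x (b i) ^ 2 := by
    rw [← b.sum_inner_mul_inner]
    refine Finset.sum_congr rfl fun i _ => ?_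
    rw [hSb, real_inner_comm x (b i)]
    ring
  have h2 : ‖x‖ ^ 2 = ∑ i, inner ℝ x (b i) ^ 2 := by
    rw [← real_inner_self_eq_norm_sq, ← b.sum_inner_mul_inner]
    refine Finset.sum_congr rfl fun i _ => ?_
    rw [real_inner_comm x (b i)]
    ring
  have h3 : ‖S x‖ ^ 2 = ∑ i, l i ^ 2 * inner ℝ x (b i) ^ 2 := by
    rw [← real_inner_self_eq_norm_sq, ← b.sum_inner_mul_inner]
    refine Finset.sum_congr rfl fun i _ => ?_
    rw [real_inner_comm (S x) (b i), hSb]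
    ring
  constructor
  · rw [h1, h2, Finset.mul_sum]
    exact Finset.sum_le_sum fun i _ => mul_le_mul_of_nonneg_right (hcl i) (sq_nonneg _)
  · rw [h1, h3, Finset.mul_sum]
    refine Finset.sum_le_sum fun i _ => ?_
    rw [← mul_assoc, sq (l i)]
    exact mul_le_mul_of_nonneg_right
      (mul_le_mul_of_nonneg_right (hlC i) (hc.trans (hcl i))) (sq_nonneg _)

variable {n : ℕ} {M : Type*} [TopologicalSpace M] [ChartedSpace (EuclideanSpace ℝ (Fin n)) M]
  {F ν : M → EuclideanSpace ℝ (Fin (n + 1))} {Ω : Set (EuclideanSpace ℝ (Fin (n + 1)))}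

theorem inner_differential_normal_self [IsManifold (𝓡 n) ∞ M]
    (hν : IsOutwardUnitNormal F Ω ν) (p : M) (v : EuclideanSpace ℝ (Fin n)) :
    inner ℝ (differential ν p v) (ν p) = 0 := by
  refine inner_differential_eq_zero_of_isMax hν.contMDiff (fun q => ?_) v
  rw [real_inner_self_eq_norm_sq, hν.norm_eq_one]
  simpa [hν.norm_eq_one] using real_inner_le_norm (ν q) (ν p)

/-- Differentiating `⟨dF w, ν⟩ = 0` in a chart identifies the second fundamental form with
`-⟨D²F, ν⟩`, which is symmetric. -/
theorem secondForm_comm [IsManifold (𝓡 n) ∞ M] (hF : ContMDiff (𝓡 n) (𝓡 (n + 1)) ∞ F)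
    (hν : IsOutwardUnitNormal F Ω ν) (p : M) (v w : EuclideanSpace ℝ (Fin n)) :
    secondForm F ν p v w = secondForm F ν p w v := by
  set φ := chartAt (EuclideanSpace ℝ (Fin n)) p with hφ
  have hx : φ p ∈ φ.target := φ.map_source (mem_chart_source _ p)
  have hσ : φ.symm (φ p) = p := φ.left_inv (mem_chart_source _ p)
  have hf := contDiffAt_comp_chart_symm hF p hx
  have hN := (contDiffAt_comp_chart_symm hν.contMDiff p hx).differentiableAt (by simp)
  have hf' : DifferentiableAt ℝ (fderiv ℝ (F ∘ φ.symm)) (φ p) :=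
    (hf.fderiv_right (m := 1) (by norm_cast)).differentiableAt (by simp)
  have hconst : ∀ b : EuclideanSpace ℝ (Fin n), DifferentiableAt ℝ
      (fun _ : EuclideanSpace ℝ (Fin n) => b) (φ p) := fun b => differentiableAt_const b
  have key : ∀ a b : EuclideanSpace ℝ (Fin n),
      inner ℝ (fderiv ℝ (ν ∘ φ.symm) (φ p) a) (fderiv ℝ (F ∘ φ.symm) (φ p) b) =
        - inner ℝ (fderiv ℝ (fderiv ℝ (F ∘ φ.symm)) (φ p) a b) (ν p) := by
    intro a b
    have h0 : (fun x => inner ℝ (fderiv ℝ (F ∘ φ.symm) x b) ((ν ∘ φ.symm) x)) =ᶠ[𝓝 (φ p)]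
        fun _ => (0 : ℝ) := by
      filter_upwards [φ.open_target.mem_nhds hx] with x hx
      obtain ⟨T, -, hT⟩ := exists_fderiv_comp_chart_symm p hx
      rw [hT F hF]
      exact hν.normal _ _
    have h1 : fderiv ℝ (fun x => inner ℝ (fderiv ℝ (F ∘ φ.symm) x b) ((ν ∘ φ.symm) x))
        (φ p) a = 0 := by
      rw [h0.fderiv_eq]; simp
    rw [fderiv_inner_apply ℝ (hf'.clm_apply (hconst b)) hN,
      fderiv_clm_apply hf' (hconst b)] at h1
    have hσ' : (ν ∘ φ.symm) (φ p) = ν p := congrArg ν hσ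
    rw [hσ'] at h1
    rw [real_inner_comm, eq_neg_iff_add_eq_zero]
    simpa using h1
  have hsymm := hf.isSymmSndFDerivAt
    (by rw [minSmoothness_of_isRCLikeNormedField]; exact ENat.LEInfty.out)
  obtain ⟨T, hT, hTG⟩ := exists_fderiv_comp_chart_symm p hx
  obtain ⟨a, rfl⟩ := hT.surjective v
  obtain ⟨b, rfl⟩ := hT.surjective w
  have h1 := key a b
  have h2 := key b a
  rw [hsymm.eq a b, ← h2] at h1
  rw [hTG F hF, hTG F hF, hTG ν hν.contMDiff, hTG ν hν.contMDiff, hσ] at h1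
  exact h1

/-- Bounds for the Weingarten map `dF v ↦ dν v` of the tangent hyperplane. It is symmetric, its
eigenvalues are the principal curvatures, and its trace is the mean curvature. Hence all principal
curvatures lie in `[c, C]`. -/
theorem curvature_bounds [IsManifold (𝓡 n) ∞ M] (hF : IsConvexEmbedding F Ω)
    (hν : IsOutwardUnitNormal F Ω ν) {p : M} {c C : ℝ} (hc : 0 < c)
    (hH : meanCurvature F ν p ≤ C) (hl : c ≤ lambdaOne F ν p) (v : EuclideanSpace ℝ (Fin n)) :
    c * ‖differential F p v‖ ≤ ‖differential ν p v‖ ∧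
      ‖differential ν p v‖ ^ 2 ≤ C * inner ℝ (differential F p v) (differential ν p v) := by
  have hinj := differential_injective hF.isSmoothEmbedding.isImmersion p
  set A := (differential F p).toLinearMap with hA
  set R := LinearMap.range A with hR
  have hν0 : ν p ≠ 0 := by
    intro h; have := hν.norm_eq_one p; simp [h] at this
  have hBR : ∀ u, (differential ν p).toLinearMap u ∈ R := by
    intro u
    rw [← Submodule.orthogonal_orthogonal R, Submodule.mem_orthogonal]
    intro w hw
    obtain ⟨μ, rfl⟩ := exists_eq_smul_of_orthogonal hinj hν0 (hν.normal p)
      (fun z => (Submodule.mem_orthogonal _ _).1 hw _ ⟨z, rfl⟩)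
    rw [real_inner_comm, inner_smul_right]
    exact mul_eq_zero_of_right _ (inner_differential_normal_self hν p u)
  let e : EuclideanSpace ℝ (Fin n) ≃ₗ[ℝ] R := LinearEquiv.ofInjective A hinj
  let B : EuclideanSpace ℝ (Fin n) →ₗ[ℝ] R := (differential ν p).toLinearMap.codRestrict R hBR
  let W : EuclideanSpace ℝ (Fin n) →ₗ[ℝ] EuclideanSpace ℝ (Fin n) := e.symm.toLinearMap ∘ₗ B
  let S : R →ₗ[ℝ] R := e.conj W
  have he : ∀ u, ((e u : R) : EuclideanSpace ℝ (Fin (n + 1))) = differential F p u := fun u => rfl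
  have hB : ∀ u, ((B u : R) : EuclideanSpace ℝ (Fin (n + 1))) = differential ν p u := fun u => rfl
  have hSe : ∀ u, S (e u) = B u := by
    intro u
    simp [S, W, LinearEquiv.conj_apply]
  have hSsymm : S.IsSymmetric := by
    intro x y
    obtain ⟨a, rfl⟩ := e.surjective x
    obtain ⟨b, rfl⟩ := e.surjective y
    rw [hSe, hSe, Submodule.coe_inner, Submodule.coe_inner, he, he, hB, hB,
      real_inner_comm (differential ν p b)]
    exact secondForm_comm hF.isSmoothEmbedding.contMDiff hν p a b
  have hev : ∀ κ, Module.End.HasEigenvalue S κ → c ≤ κ := by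
    intro κ hκ
    -- The `sInf` of a set that is not bounded below is `0`, which is less than `c`.
    have hbdd : BddBelow {κ : ℝ | IsPrincipalCurvature F ν p κ} := by
      by_contra hcon
      have := hl
      rw [lambdaOne, Real.sInf_of_not_bddBelow hcon] at this
      linarith
    refine hl.trans (csInf_le hbdd ?_)
    obtain ⟨x, hx⟩ := hκ.exists_hasEigenvector
    obtain ⟨a, rfl⟩ := e.surjective x
    refine ⟨a, fun h => hx.2 (by simp [h]), fun w => ?_⟩
    have h1 := congrArg (fun z : R => (z : EuclideanSpace ℝ (Fin (n + 1)))) hx.apply_eq_smul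
    simp only [hSe, hB, Submodule.coe_smul, he] at h1
    rw [secondForm, firstForm, h1, inner_smul_left]
    rfl
  have htr : LinearMap.trace ℝ R S ≤ C := by
    refine le_trans (le_of_eq ?_) hH
    rw [LinearMap.trace_conj',
      LinearMap.trace_eq_matrix_trace ℝ (EuclideanSpace.basisFun (Fin n) ℝ).toBasis, meanCurvature]
    set G : Matrix (Fin n) (Fin n) ℝ := Matrix.of fun i j : Fin n =>
        firstForm F p (EuclideanSpace.single i 1) (EuclideanSpace.single j 1) with hG
    set m := LinearMap.toMatrix (EuclideanSpace.basisFun (Fin n) ℝ).toBasis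
      (EuclideanSpace.basisFun (Fin n) ℝ).toBasis W with hm
    have hlin : LinearIndependent ℝ
        fun i : Fin n => differential F p (EuclideanSpace.single i (1 : ℝ)) := by
      have := (EuclideanSpace.basisFun (Fin n) ℝ).toBasis.linearIndependent.map' A
        (LinearMap.ker_eq_bot.2 hinj)
      have hcomp : (fun i : Fin n => differential F p (EuclideanSpace.single i (1 : ℝ))) =
          A ∘ (EuclideanSpace.basisFun (Fin n) ℝ).toBasis := by
        ext i : 1
        simp [hA]
      rw [hcomp]
      exact this
    have hdet : IsUnit G.det := by
      have := (Matrix.posDef_gram_of_linearIndependent hlin).det_pos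
      exact (show 0 < G.det from this).ne'.isUnit
    have hHm : (Matrix.of fun i j : Fin n =>
        secondForm F ν p (EuclideanSpace.single i 1) (EuclideanSpace.single j 1)) =
        m.transpose * G := by
      ext i j
      have h1 : differential ν p (EuclideanSpace.single i 1) =
          differential F p (W (EuclideanSpace.single i 1)) := by
        rw [← he, ← hB]
        simp [W]
      have h2 : W (EuclideanSpace.single i 1) =
          ∑ k, m k i • EuclideanSpace.single k (1 : ℝ) := by
        rw [← (EuclideanSpace.basisFun (Fin n) ℝ).toBasis.sum_repr (W (EuclideanSpace.single i 1))]
        refine Finset.sum_congr rfl fun k _ => ?_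
        simp [hm, LinearMap.toMatrix_apply]
      simp only [Matrix.of_apply, secondForm, h1, h2, map_sum, map_smul, sum_inner,
        inner_smul_left, Matrix.mul_apply, Matrix.transpose_apply, hG, firstForm]
      rfl
    rw [hHm, Matrix.trace_mul_comm, Matrix.mul_assoc, Matrix.mul_nonsing_inv _ hdet,
      Matrix.mul_one, Matrix.trace_transpose]
  obtain ⟨h1, h2⟩ := LinearMap.IsSymmetric.inner_bounds hSsymm hc.le hev htr (e v)
  rw [hSe, Submodule.coe_inner, he, hB, ← Submodule.norm_coe (e v), he] at h1
  rw [hSe, Submodule.coe_inner, he, hB, ← Submodule.norm_coe (B v), hB, real_inner_comm] at h2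
  refine ⟨?_, h2⟩
  rcases (norm_nonneg (differential F p v)).eq_or_lt with h0 | h0
  · rw [← h0, mul_zero]; exact norm_nonneg _
  · have h3 := real_inner_le_norm (differential ν p v) (differential F p v)
    nlinarith

end Curvature

/-! ### A local inverse of the Gauss map -/

section GaussMap

variable {n : ℕ} {M : Type*} [TopologicalSpace M] [ChartedSpace (EuclideanSpace ℝ (Fin n)) M]
  {F ν : M → EuclideanSpace ℝ (Fin (n + 1))} {Ω : Set (EuclideanSpace ℝ (Fin (n + 1)))}

/-- The estimate extends from `D` to its closure by continuity. The preferred charts at different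
points differ, so the limit is taken in the chart at `q₀`. -/
theorem norm_differential_le_of_mem_closure [IsManifold (𝓡 n) ∞ M]
    (hF : ContMDiff (𝓡 n) (𝓡 (n + 1)) ∞ F) (hν : ContMDiff (𝓡 n) (𝓡 (n + 1)) ∞ ν) {D : Set M}
    {K : ℝ} (hK : ∀ q ∈ D, ∀ v, ‖differential F q v‖ ≤ K * ‖differential ν q v‖) {q₀ : M}
    (hq₀ : q₀ ∈ closure D) (v : EuclideanSpace ℝ (Fin n)) :
    ‖differential F q₀ v‖ ≤ K * ‖differential ν q₀ v‖ := by
  set φ := chartAt (EuclideanSpace ℝ (Fin n)) q₀ with hφ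
  have hx : φ q₀ ∈ φ.target := φ.map_source (mem_chart_source _ q₀)
  have hσ : φ.symm (φ q₀) = q₀ := φ.left_inv (mem_chart_source _ q₀)
  obtain ⟨T, hT, hTG⟩ := exists_fderiv_comp_chart_symm q₀ hx
  obtain ⟨u, rfl⟩ := hT.surjective v
  have hφc : Filter.Tendsto φ (𝓝[D] q₀) (𝓝 (φ q₀)) :=
    (φ.continuousAt (mem_chart_source _ q₀)).tendsto.mono_left nhdsWithin_le_nhds
  have hlim : ∀ G : M → EuclideanSpace ℝ (Fin (n + 1)), ContMDiff (𝓡 n) (𝓡 (n + 1)) ∞ G →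
      Filter.Tendsto (fun q => ‖fderiv ℝ (G ∘ φ.symm) (φ q) u‖) (𝓝[D] q₀)
        (𝓝 ‖differential G q₀ (T u)‖) := by
    intro G hG
    have h1 : ContinuousAt (fun x => ‖fderiv ℝ (G ∘ φ.symm) x u‖) (φ q₀) :=
      ((((contDiffAt_comp_chart_symm hG q₀ hx).fderiv_right (m := 0)
        (by norm_cast)).continuousAt).clm_apply continuousAt_const).norm
    have h2 := h1.tendsto.comp hφc
    rw [hTG G hG, hσ] at h2
    exact h2
  have : (𝓝[D] q₀).NeBot := mem_closure_iff_nhdsWithin_neBot.1 hq₀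
  refine le_of_tendsto_of_tendsto (hlim F hF) ((hlim ν hν).const_mul K) ?_
  filter_upwards [self_mem_nhdsWithin,
    nhdsWithin_le_nhds (φ.open_source.mem_nhds (mem_chart_source _ q₀))] with q hqD hq
  obtain ⟨T', -, hT'⟩ := exists_fderiv_comp_chart_symm q₀ (φ.map_source hq)
  rw [hT' F hF, hT' ν hν]
  exact hK _ (by rwa [φ.left_inv hq]) _

/-- Where the differential of the Gauss map `ν` is injective, `ν` has a `C¹` local inverse `Γ`, here
extended to a neighbourhood of `ν q₀` in `ℝ^{n+1}`. The inverse function theorem is applied to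
`(x, s) ↦ (1 + s) ν(x)` in a chart; on unit vectors its inverse has `s = 0`. -/
theorem exists_local_inverse_gauss [IsManifold (𝓡 n) ∞ M]
    (hν : ContMDiff (𝓡 n) (𝓡 (n + 1)) ∞ ν) (hν1 : ∀ q, ‖ν q‖ = 1) {q₀ : M}
    (hperp : ∀ v, inner ℝ (differential ν q₀ v) (ν q₀) = 0)
    (hinj : Function.Injective (differential ν q₀)) :
    ∃ Γ : EuclideanSpace ℝ (Fin (n + 1)) → M,
      (∀ᶠ y in 𝓝 (ν q₀), ContMDiffAt (𝓡 (n + 1)) (𝓡 n) 1 Γ y ∧ (‖y‖ = 1 → ν (Γ y) = y)) ∧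
      ∀ᶠ q in 𝓝 q₀, Γ (ν q) = q := by
  set φ := chartAt (EuclideanSpace ℝ (Fin n)) q₀ with hφ
  have hx : φ q₀ ∈ φ.target := φ.map_source (mem_chart_source _ q₀)
  have hσ : φ.symm (φ q₀) = q₀ := φ.left_inv (mem_chart_source _ q₀)
  obtain ⟨T, hT, hTG⟩ := exists_fderiv_comp_chart_symm q₀ hx
  set N : EuclideanSpace ℝ (Fin n) → EuclideanSpace ℝ (Fin (n + 1)) := ν ∘ φ.symm with hN
  have hNc : ContDiffAt ℝ 1 N (φ q₀) :=
    (contDiffAt_comp_chart_symm hν q₀ hx).of_le (by exact_mod_cast le_top)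
  have hN0 : N (φ q₀) = ν q₀ := by simp [hN, hσ]
  set Φ : EuclideanSpace ℝ (Fin n) × ℝ → EuclideanSpace ℝ (Fin (n + 1)) :=
    fun z => (1 + z.2) • N z.1 with hΦ
  set z₀ : EuclideanSpace ℝ (Fin n) × ℝ := (φ q₀, 0) with hz₀
  have hΦc : ContDiffAt ℝ 1 Φ z₀ :=
    (contDiffAt_const.add contDiffAt_snd).smul
      (ContDiffAt.comp (g := N) (f := Prod.fst) z₀ hNc contDiffAt_fst)
  have hΦ0 : Φ z₀ = ν q₀ := by simp [hΦ, hz₀, hN0]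
  have hΦd : ∀ z, fderiv ℝ Φ z₀ z = fderiv ℝ N (φ q₀) z.1 + z.2 • ν q₀ := by
    intro z
    have h1 : HasFDerivAt (fun z : EuclideanSpace ℝ (Fin n) × ℝ => 1 + z.2)
        (ContinuousLinearMap.snd ℝ (EuclideanSpace ℝ (Fin n)) ℝ) z₀ :=
      hasFDerivAt_snd.const_add 1
    have h2 : HasFDerivAt (fun z : EuclideanSpace ℝ (Fin n) × ℝ => N z.1)
        ((fderiv ℝ N (φ q₀)).comp (ContinuousLinearMap.fst ℝ (EuclideanSpace ℝ (Fin n)) ℝ)) z₀ :=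
      HasFDerivAt.comp (g := N) (f := Prod.fst) z₀ (hNc.differentiableAt (by simp)).hasFDerivAt
        hasFDerivAt_fst
    have h3 := HasFDerivAt.fderiv (f := Φ) (h1.smul h2)
    rw [h3]
    simp [hz₀, hN0]
  have hΦinj : Function.Injective (fderiv ℝ Φ z₀).toLinearMap := by
    rw [← LinearMap.ker_eq_bot, LinearMap.ker_eq_bot']
    rintro ⟨v, s⟩ hvs
    have h1 : fderiv ℝ N (φ q₀) v + s • ν q₀ = 0 := (hΦd (v, s)).symm.trans hvs
    rw [hN, hTG ν hν, hσ] at h1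
    have h2 := congrArg (fun y => inner ℝ y (ν q₀)) h1
    simp only [inner_add_left, hperp, inner_smul_left, real_inner_self_eq_norm_sq, hν1,
      inner_zero_left, conj_trivial] at h2
    have hs : s = 0 := by linarith
    rw [hs, zero_smul, add_zero, ← map_zero (differential ν q₀)] at h1
    have h3 := hinj h1
    rw [← map_zero T] at h3
    rw [hT.injective h3, hs]
    rfl
  let L : (EuclideanSpace ℝ (Fin n) × ℝ) ≃L[ℝ] EuclideanSpace ℝ (Fin (n + 1)) :=
    (LinearMap.linearEquivOfInjective (fderiv ℝ Φ z₀).toLinearMap hΦinj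
      (by simp)).toContinuousLinearEquiv
  have hL : HasFDerivAt Φ (L : (EuclideanSpace ℝ (Fin n) × ℝ) →L[ℝ] _) z₀ := by
    have h1 : (L : (EuclideanSpace ℝ (Fin n) × ℝ) →L[ℝ] EuclideanSpace ℝ (Fin (n + 1))) =
        fderiv ℝ Φ z₀ := by
      refine ContinuousLinearMap.ext fun z => ?_
      rfl
    rw [h1]
    exact (hΦc.differentiableAt (by simp)).hasFDerivAt
  set P := hΦc.toOpenPartialHomeomorph Φ hL one_ne_zero with hP
  have hPc : ∀ z, P z = Φ z := fun z => rfl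
  have hzs : z₀ ∈ P.source := hΦc.mem_toOpenPartialHomeomorph_source hL one_ne_zero
  have hyt : ν q₀ ∈ P.target := hΦ0 ▸ P.map_source hzs
  have hG0 : P.symm (ν q₀) = z₀ := by rw [← hΦ0]; exact P.left_inv hzs
  have hGc : ContDiffAt ℝ 1 P.symm (ν q₀) := by
    rw [← hΦ0]; exact hΦc.to_localInverse hL one_ne_zero
  refine ⟨fun y => φ.symm (P.symm y).1, ?_, ?_⟩
  · have h1 : ∀ᶠ y in 𝓝 (ν q₀), (P.symm y).1 ∈ φ.target ∧ |(P.symm y).2| < 1 := by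
      have hcont := hGc.continuousAt
      rw [ContinuousAt, hG0] at hcont
      refine hcont.eventually (p := fun z => z.1 ∈ φ.target ∧ |z.2| < 1) ?_
      refine Filter.Eventually.and ?_ ?_
      · exact continuousAt_fst.eventually (φ.open_target.mem_nhds hx)
      · exact (continuous_snd.abs.continuousAt (x := z₀)).eventually_lt continuousAt_const
          (by simp [hz₀])
    filter_upwards [h1, hGc.eventually (by simp), P.open_target.mem_nhds hyt] with y hy hyc hyP
    refine ⟨?_, fun hy1 => ?_⟩
    · have h2 : ContMDiffAt (𝓡 (n + 1)) (𝓡 n) 1 (fun y => (P.symm y).1) y :=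
        (ContDiffAt.fst hyc).contMDiffAt
      have h3 : ContMDiffAt (𝓡 n) (𝓡 n) 1 φ.symm (P.symm y).1 :=
        ((contMDiffOn_chart_symm (n := ∞)).contMDiffAt (φ.open_target.mem_nhds hy.1)).of_le
          (by exact_mod_cast le_top)
      exact h3.comp y h2
    · have h2 : (1 + (P.symm y).2) • N (P.symm y).1 = y := P.right_inv hyP
      have h3 : ‖N (P.symm y).1‖ = 1 := hν1 _
      have h4 : 1 + (P.symm y).2 = 1 := by
        have h5 := congrArg norm h2
        rw [norm_smul, h3, hy1, mul_one, Real.norm_eq_abs,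
          abs_of_pos (by linarith [(abs_lt.1 hy.2).1])] at h5
        exact h5
      rw [h4, one_smul] at h2
      exact h2
  · have h1 : ∀ᶠ q in 𝓝 q₀, ((φ q, 0) : EuclideanSpace ℝ (Fin n) × ℝ) ∈ P.source := by
      have hc : ContinuousAt (fun q => ((φ q, 0) : EuclideanSpace ℝ (Fin n) × ℝ)) q₀ :=
        (φ.continuousAt (mem_chart_source _ q₀)).prodMk continuousAt_const
      exact hc.eventually (P.open_source.mem_nhds hzs)
    filter_upwards [h1, φ.open_source.mem_nhds (mem_chart_source _ q₀)] with q hq hqs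
    have h2 : P (φ q, 0) = ν q := by
      rw [hPc]; simp [hΦ, hN, φ.left_inv hqs]
    simp only [← h2, P.left_inv hq, φ.left_inv hqs]

end GaussMap

/-! ### Great circles and lengths of curves -/

section GreatCircle

variable {V : Type*} [NormedAddCommGroup V] [InnerProductSpace ℝ V]

/-- The unit speed great circle through `u` in the direction `e`, for orthonormal `u` and `e`. -/
noncomputable def greatCircle (u e : V) (t : ℝ) : V := Real.cos t • u + Real.sin t • e

theorem contDiff_greatCircle (u e : V) : ContDiff ℝ ∞ (greatCircle u e) :=
  (Real.contDiff_cos.smul contDiff_const).add (Real.contDiff_sin.smul contDiff_const)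

theorem hasDerivAt_greatCircle (u e : V) (t : ℝ) :
    HasDerivAt (greatCircle u e) (-Real.sin t • u + Real.cos t • e) t :=
  ((Real.hasDerivAt_cos t).smul_const u).add ((Real.hasDerivAt_sin t).smul_const e)

variable {u e : V}

theorem inner_greatCircle (hu : ‖u‖ = 1) (hue : inner ℝ u e = 0) (t : ℝ) :
    inner ℝ u (greatCircle u e t) = Real.cos t := by
  simp [greatCircle, inner_add_right, inner_smul_right, hu, hue]

theorem norm_greatCircle (hu : ‖u‖ = 1) (he : ‖e‖ = 1) (hue : inner ℝ u e = 0) (t : ℝ) :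
    ‖greatCircle u e t‖ = 1 := by
  rw [← sq_eq_sq₀ (norm_nonneg _) zero_le_one, ← real_inner_self_eq_norm_sq]
  simp only [greatCircle, inner_add_left, inner_add_right, inner_smul_left, inner_smul_right,
    real_inner_self_eq_norm_sq, hu, he, hue, real_inner_comm u e, conj_trivial]
  nlinarith [Real.sin_sq_add_cos_sq t]

theorem norm_deriv_greatCircle (hu : ‖u‖ = 1) (he : ‖e‖ = 1) (hue : inner ℝ u e = 0) (t : ℝ) :
    ‖-Real.sin t • u + Real.cos t • e‖ = 1 := by
  rw [← sq_eq_sq₀ (norm_nonneg _) zero_le_one, ← real_inner_self_eq_norm_sq]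
  simp only [inner_add_left, inner_add_right, inner_smul_left, inner_smul_right,
    real_inner_self_eq_norm_sq, hu, he, hue, real_inner_comm u e, conj_trivial]
  nlinarith [Real.sin_sq_add_cos_sq t]

theorem greatCircle_eq_add (u e : V) (t T : ℝ) :
    greatCircle u e T = Real.cos (T - t) • greatCircle u e t +
      Real.sin (T - t) • (-Real.sin t • u + Real.cos t • e) := by
  have h1 : Real.cos T = Real.cos (T - t) * Real.cos t - Real.sin (T - t) * Real.sin t := by
    rw [← Real.cos_add]; congr 1; ring
  have h2 : Real.sin T = Real.sin (T - t) * Real.cos t + Real.cos (T - t) * Real.sin t := by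
    rw [← Real.sin_add]; congr 1; ring
  simp only [greatCircle, h1, h2]
  module

/-- Unit vectors `u`, `w` are joined by a great circle of length the angle between them. The vector
`e₀` serves as its direction if `w = ± u`. -/
theorem exists_greatCircle_eq {w e₀ : V} (hu : ‖u‖ = 1) (hw : ‖w‖ = 1) (he₀ : ‖e₀‖ = 1)
    (hue₀ : inner ℝ u e₀ = 0) :
    ∃ e : V, ‖e‖ = 1 ∧ inner ℝ u e = 0 ∧
      greatCircle u e (InnerProductGeometry.angle u w) = w := by
  set T := InnerProductGeometry.angle u w with hT
  have hcos : Real.cos T = inner ℝ u w := by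
    rw [hT, InnerProductGeometry.cos_angle, hu, hw]; simp
  have hn : ‖w - Real.cos T • u‖ ^ 2 = Real.sin T ^ 2 := by
    rw [← real_inner_self_eq_norm_sq]
    simp only [inner_sub_left, inner_sub_right, inner_smul_left, inner_smul_right,
      real_inner_self_eq_norm_sq, hu, hw, real_inner_comm u w, ← hcos, conj_trivial]
    nlinarith [Real.sin_sq_add_cos_sq T]
  have hs0 : 0 ≤ Real.sin T := InnerProductGeometry.sin_angle_nonneg u w
  have hn' : ‖w - Real.cos T • u‖ = Real.sin T := (sq_eq_sq₀ (norm_nonneg _) hs0).1 hn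
  rcases hs0.eq_or_lt with hs | hs
  · refine ⟨e₀, he₀, hue₀, ?_⟩
    rw [← hs, norm_eq_zero, sub_eq_zero] at hn'
    rw [greatCircle, ← hs, zero_smul, add_zero, ← hn']
  · refine ⟨(Real.sin T)⁻¹ • (w - Real.cos T • u), ?_, ?_, ?_⟩
    · rw [norm_smul, hn', Real.norm_eq_abs, abs_of_pos (inv_pos.2 hs), inv_mul_cancel₀ hs.ne']
    · rw [inner_smul_right, inner_sub_right, inner_smul_right, real_inner_self_eq_norm_sq, hu,
        ← hcos]
      ring
    · rw [greatCircle, smul_inv_smul₀ hs.ne']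
      abel

end GreatCircle

section Curve

variable {n : ℕ} {M : Type*} [TopologicalSpace M] [ChartedSpace (EuclideanSpace ℝ (Fin n)) M]
  {F ν : M → EuclideanSpace ℝ (Fin (n + 1))} {Ω : Set (EuclideanSpace ℝ (Fin (n + 1)))}

theorem enorm_differential_smul (F : M → EuclideanSpace ℝ (Fin (n + 1))) (p : M) (a : ℝ)
    (v : EuclideanSpace ℝ (Fin n)) :
    ‖differential F p (a • v)‖ₑ = ‖a‖ₑ * ‖differential F p v‖ₑ := by
  rw [map_smul, enorm_smul]

theorem intrinsicDist_self (F : M → EuclideanSpace ℝ (Fin (n + 1))) (p : M) :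
    intrinsicDist F p p = 0 := by
  let : ∀ x : M, ENorm (TangentSpace (𝓡 n) x) := fun x => ⟨fun v => ‖differential F x v‖ₑ⟩
  have : ∀ x : M, ENormSMulClass ℝ (TangentSpace (𝓡 n) x) := fun x =>
    ⟨enorm_differential_smul F x⟩
  exact Manifold.riemannianEDist_self

theorem intrinsicDist_triangle (F : M → EuclideanSpace ℝ (Fin (n + 1))) (p q r : M) :
    intrinsicDist F p r ≤ intrinsicDist F p q + intrinsicDist F q r := by
  let : ∀ x : M, ENorm (TangentSpace (𝓡 n) x) := fun x => ⟨fun v => ‖differential F x v‖ₑ⟩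
  have : ∀ x : M, ENormSMulClass ℝ (TangentSpace (𝓡 n) x) := fun x =>
    ⟨enorm_differential_smul F x⟩
  exact Manifold.riemannianEDist_triangle

/-- A curve of speed at most `K` on an interval of length `ℓ` has length at most `K ℓ`. -/
theorem intrinsicDist_le_of_speed_le {c : ℝ → M} {ℓ K : ℝ} (hℓ : 0 ≤ ℓ)
    (hc : ∀ s ∈ Set.Icc 0 ℓ, ContMDiffAt 𝓘(ℝ, ℝ) (𝓡 n) 1 c s)
    (hK : ∀ s ∈ Set.Ioo 0 ℓ,
      ‖differential F (c s) (mfderiv 𝓘(ℝ, ℝ) (𝓡 n) c s (1 : ℝ))‖ ≤ K) :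
    intrinsicDist F (c 0) (c ℓ) ≤ ENNReal.ofReal (K * ℓ) := by
  let : ∀ x : M, ENorm (TangentSpace (𝓡 n) x) := fun x => ⟨fun v => ‖differential F x v‖ₑ⟩
  have : ∀ x : M, ENormSMulClass ℝ (TangentSpace (𝓡 n) x) := fun x =>
    ⟨enorm_differential_smul F x⟩
  refine (Manifold.riemannianEDist_le_pathELength (I := 𝓡 n)
    (fun s hs => (hc s hs).contMDiffWithinAt) rfl rfl hℓ).trans ?_
  rw [Manifold.pathELength_eq_lintegral_mfderiv_Ioo]
  calc _ ≤ ∫⁻ _ in Set.Ioo 0 ℓ, ENNReal.ofReal K := by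
        refine MeasureTheory.setLIntegral_mono' measurableSet_Ioo fun s hs => ?_
        change ‖differential F (c s) (mfderiv 𝓘(ℝ, ℝ) (𝓡 n) c s (1 : ℝ))‖ₑ ≤ _
        rw [← ofReal_norm]
        exact ENNReal.ofReal_le_ofReal (hK s hs)
    _ = ENNReal.ofReal (K * ℓ) := by
        rw [MeasureTheory.setLIntegral_const, Real.volume_Ioo, sub_zero, mul_comm K,
          ENNReal.ofReal_mul hℓ, mul_comm]

end Curve

/-! ### Lifting great circles through the Gauss map -/

section Continuation

variable {n : ℕ} {M : Type*} [TopologicalSpace M] [ChartedSpace (EuclideanSpace ℝ (Fin n)) M]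
  {F ν : M → EuclideanSpace ℝ (Fin (n + 1))} {Ω : Set (EuclideanSpace ℝ (Fin (n + 1)))}
  {u e : EuclideanSpace ℝ (Fin (n + 1))}

/-- The point `q` of `D` is what the end of a lift through the Gauss map `ν`, from `p`, of the
great circle `greatCircle u e` up to time `t` should be: its normal is the point at time `t`, its
distances from `p` obey the speed bound `K`, and its height over `p` in the direction of the point
at time `T` is bounded below by a multiple `k` of the height gained on the unit sphere. Only
points are recorded, not the lifted curves, so that no curves have to be glued. -/
structure IsReached (F ν : M → EuclideanSpace ℝ (Fin (n + 1))) (D : Set M) (p : M)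
    (u e : EuclideanSpace ℝ (Fin (n + 1))) (K k T t : ℝ) (q : M) : Prop where
  mem : q ∈ D
  normal_eq : ν q = greatCircle u e t
  dist_le : intrinsicDist F p q ≤ ENNReal.ofReal (K * t)
  norm_le : ‖F q - F p‖ ≤ K * t
  height_ge : k * (Real.cos (T - t) - Real.cos T) ≤ inner ℝ (F q - F p) (greatCircle u e T)

/-- A continuous curve leaves an open set through its frontier, so it stays in the set if it is not
on the frontier at a first time of exit. -/
theorem forall_mem_of_first_exit {X : Type*} [TopologicalSpace X] {D : Set X}
    (hD : IsOpen D) {c : ℝ → X} {ℓ : ℝ} (hc : ∀ s ∈ Set.Icc 0 ℓ, ContinuousAt c s) (h0 : c 0 ∈ D)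
    (hexit : ∀ s ∈ Set.Icc 0 ℓ, (∀ s' ∈ Set.Ico 0 s, c s' ∈ D) → c s ∉ frontier D) :
    ∀ s ∈ Set.Icc 0 ℓ, c s ∈ D := by
  by_contra! hcon
  have hcont : ContinuousOn c (Set.Icc 0 ℓ) := fun s hs => (hc s hs).continuousWithinAt
  have hcomp : IsCompact (Set.Icc 0 ℓ ∩ c ⁻¹' Dᶜ) :=
    isCompact_Icc.of_isClosed_subset
      (hcont.preimage_isClosed_of_isClosed isClosed_Icc hD.isClosed_compl) Set.inter_subset_left
  obtain ⟨s₁, ⟨hs₁, hs₁D⟩, hmin⟩ := hcomp.exists_isLeast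
    (by obtain ⟨s, hs, hsD⟩ := hcon; exact ⟨s, hs, hsD⟩)
  have hbefore : ∀ s' ∈ Set.Ico 0 s₁, c s' ∈ D := by
    intro s' hs'
    by_contra hs'D
    exact absurd (hmin ⟨⟨hs'.1, hs'.2.le.trans hs₁.2⟩, hs'D⟩) (not_le.2 hs'.2)
  have hpos : 0 < s₁ := by
    rcases hs₁.1.eq_or_lt with h | h
    · exact absurd (h ▸ h0) hs₁D
    · exact h
  refine hexit s₁ hs₁ hbefore ?_
  rw [hD.frontier_eq]
  refine ⟨mem_closure_of_tendsto
    ((hc s₁ hs₁).tendsto.mono_left (nhdsWithin_le_nhds (s := Set.Iio s₁))) ?_, hs₁D⟩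
  filter_upwards [Ico_mem_nhdsLT hpos] with s hs using hbefore s hs

variable [IsManifold (𝓡 n) ∞ M]

/-- Speed and direction of a lift `c` of a great circle through the Gauss map. Since the velocity of
`F ∘ c` is tangent, only its component along the velocity of the great circle contributes to the
derivative of the height in the direction `greatCircle u e T`. -/
theorem hasDerivAt_of_lift (hF : ContMDiff (𝓡 n) (𝓡 (n + 1)) ∞ F)
    (hν : ContMDiff (𝓡 n) (𝓡 (n + 1)) ∞ ν) (hu : ‖u‖ = 1) (he : ‖e‖ = 1) (hue : inner ℝ u e = 0)
    {c : ℝ → M} {t s K k : ℝ}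
    (hc : ContMDiffAt 𝓘(ℝ, ℝ) (𝓡 n) 1 c s)
    (hlift : ∀ᶠ s' in 𝓝 s, ν (c s') = greatCircle u e (t + s'))
    (hK : ∀ v, ‖differential F (c s) v‖ ≤ K * ‖differential ν (c s) v‖)
    (hk : ∀ v, k * ‖differential ν (c s) v‖ ^ 2 ≤
      inner ℝ (differential F (c s) v) (differential ν (c s) v))
    (hperp : ∀ v, inner ℝ (differential F (c s) v) (ν (c s)) = 0) :
    ∃ v : EuclideanSpace ℝ (Fin n), v = mfderiv 𝓘(ℝ, ℝ) (𝓡 n) c s (1 : ℝ) ∧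
      HasDerivAt (F ∘ c) (differential F (c s) v) s ∧ ‖differential F (c s) v‖ ≤ K ∧
      ∀ T, 0 ≤ Real.sin (T - (t + s)) → k * Real.sin (T - (t + s)) ≤
        inner ℝ (differential F (c s) v) (greatCircle u e T) := by
  have hcd := hc.mdifferentiableAt one_ne_zero
  obtain ⟨v, hv⟩ : ∃ v : EuclideanSpace ℝ (Fin n),
    v = mfderiv 𝓘(ℝ, ℝ) (𝓡 n) c s (1 : ℝ) := ⟨_, rfl⟩
  have h1 : HasDerivAt (F ∘ c) (differential F (c s) v) s := hv ▸ hasDerivAt_comp_curve hF hcd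
  have h2 : HasDerivAt (ν ∘ c) (differential ν (c s) v) s := hv ▸ hasDerivAt_comp_curve hν hcd
  have h3 : HasDerivAt (ν ∘ c)
      (-Real.sin (t + s) • u + Real.cos (t + s) • e) s :=
    ((hasDerivAt_greatCircle u e (t + s)).comp_const_add t s).congr_of_eventuallyEq hlift
  have h4 := h2.unique h3
  have h5 : ‖differential ν (c s) v‖ = 1 := by
    rw [h4]; exact norm_deriv_greatCircle hu he hue _
  refine ⟨v, hv, h1, by simpa [h5] using hK v, fun T hT => ?_⟩
  rw [greatCircle_eq_add u e (t + s) T, ← h4, ← hlift.self_of_nhds, inner_add_right,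
    inner_smul_right, inner_smul_right, hperp, mul_zero, zero_add, mul_comm]
  have h6 := hk v
  rw [h5, one_pow, mul_one] at h6
  exact mul_le_mul_of_nonneg_left h6 hT

/-- Following a lift of the great circle for a further time `ℓ`. The length of the lift keeps it
from the frontier of `D`, and the height estimate is integrated along it. -/
theorem IsReached.of_lift (hF : ContMDiff (𝓡 n) (𝓡 (n + 1)) ∞ F)
    (hν : ContMDiff (𝓡 n) (𝓡 (n + 1)) ∞ ν) (hu : ‖u‖ = 1) (he : ‖e‖ = 1) (hue : inner ℝ u e = 0)
    {D : Set M} (hD : IsOpen D) {p : M} {K k T t ℓ : ℝ} (hK0 : 0 ≤ K)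
    (hK : ∀ q ∈ D, ∀ v, ‖differential F q v‖ ≤ K * ‖differential ν q v‖)
    (hk : ∀ q ∈ D, ∀ v, k * ‖differential ν q v‖ ^ 2 ≤
      inner ℝ (differential F q v) (differential ν q v))
    (hperp : ∀ q v, inner ℝ (differential F q v) (ν q) = 0)
    (ht : 0 ≤ t) (hℓ : 0 ≤ ℓ) (htT : t + ℓ ≤ T) (hT : T ≤ Real.pi)
    (hfr : ∀ q ∈ frontier D, ENNReal.ofReal (K * (t + ℓ)) < intrinsicDist F p q)
    {c : ℝ → M} (hc : ∀ s ∈ Set.Icc 0 ℓ, ContMDiffAt 𝓘(ℝ, ℝ) (𝓡 n) 1 c s)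
    (hlift : ∀ s ∈ Set.Icc 0 ℓ, ∀ᶠ s' in 𝓝 s, ν (c s') = greatCircle u e (t + s'))
    (h : IsReached F ν D p u e K k T t (c 0)) :
    IsReached F ν D p u e K k T (t + ℓ) (c ℓ) := by
  have key : ∀ s ∈ Set.Icc 0 ℓ, c s ∈ D → _ := fun s hs hsD =>
    hasDerivAt_of_lift hF hν hu he hue (hc s hs) (hlift s hs) (hK _ hsD) (hk _ hsD) (hperp _)
  have hdist : ∀ s ∈ Set.Icc 0 ℓ, (∀ s' ∈ Set.Ico 0 s, c s' ∈ D) →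
      intrinsicDist F p (c s) ≤ ENNReal.ofReal (K * (t + s)) := by
    intro s hs hsD
    refine (intrinsicDist_triangle F p (c 0) (c s)).trans ?_
    rw [mul_add, ENNReal.ofReal_add (mul_nonneg hK0 ht) (mul_nonneg hK0 hs.1)]
    refine add_le_add h.dist_le (intrinsicDist_le_of_speed_le hs.1
      (fun s' hs' => hc s' ⟨hs'.1, hs'.2.trans hs.2⟩) fun s' hs' => ?_)
    obtain ⟨v, hv, -, hvK, -⟩ := key s' ⟨hs'.1.le, hs'.2.le.trans hs.2⟩ (hsD s' ⟨hs'.1.le, hs'.2⟩)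
    exact hv ▸ hvK
  have hmem : ∀ s ∈ Set.Icc 0 ℓ, c s ∈ D := by
    refine forall_mem_of_first_exit hD (fun s hs => (hc s hs).continuousAt) h.mem
      fun s hs hsD hfs => ?_
    refine absurd (hfr _ hfs) (not_lt.2 ((hdist s hs hsD).trans ?_))
    exact ENNReal.ofReal_le_ofReal (mul_le_mul_of_nonneg_left (by linarith [hs.2]) hK0)
  have hℓm : ℓ ∈ Set.Icc 0 ℓ := ⟨hℓ, le_rfl⟩
  refine ⟨hmem ℓ hℓm, (hlift ℓ hℓm).self_of_nhds,
    hdist ℓ hℓm fun s hs => hmem s ⟨hs.1, hs.2.le⟩, ?_, ?_⟩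
  · have h1 : ‖F (c ℓ) - F (c 0)‖ ≤ K * (ℓ - 0) := by
      refine norm_image_sub_le_of_norm_deriv_le_segment' (f := F ∘ c) (f' := deriv (F ∘ c))
        (fun s hs => ?_) (fun s hs => ?_) ℓ hℓm
      · obtain ⟨v, -, hd, -⟩ := key s hs (hmem s hs)
        exact hd.differentiableAt.hasDerivAt.hasDerivWithinAt
      · obtain ⟨v, -, hd, hvK, -⟩ := key s ⟨hs.1, hs.2.le⟩ (hmem s ⟨hs.1, hs.2.le⟩)
        rwa [hd.deriv]
    have h2 := norm_add_le (F (c ℓ) - F (c 0)) (F (c 0) - F p)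
    rw [sub_add_sub_cancel] at h2
    linarith [h.norm_le]
  · have hcos : ∀ s, HasDerivAt (fun s => k * Real.cos (T - (t + s)))
        (k * Real.sin (T - (t + s))) s := by
      intro s
      have h1 : HasDerivAt (fun s => T - (t + s)) (-1) s := by
        simpa using ((hasDerivAt_id s).const_add t).const_sub T
      simpa using (h1.cos).const_mul k
    have hmono : MonotoneOn
        (fun s => inner ℝ (F (c s)) (greatCircle u e T) - k * Real.cos (T - (t + s)))
        (Set.Icc 0 ℓ) := by
      have hder : ∀ s ∈ Set.Icc 0 ℓ, ∃ d, 0 ≤ d ∧ HasDerivAt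
          (fun s => inner ℝ (F (c s)) (greatCircle u e T) - k * Real.cos (T - (t + s))) d s := by
        intro s hs
        obtain ⟨v, -, hd, -, hsin⟩ := key s hs (hmem s hs)
        refine ⟨_, sub_nonneg.2 (hsin T (Real.sin_nonneg_of_nonneg_of_le_pi
          (by linarith [hs.2]) (by linarith [hs.1]))), HasDerivAt.sub ?_ (hcos s)⟩
        simpa using hd.inner ℝ (hasDerivAt_const s (greatCircle u e T))
      refine monotoneOn_of_deriv_nonneg (convex_Icc 0 ℓ) (fun s hs => ?_) (fun s hs => ?_)
        fun s hs => ?_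
      · obtain ⟨d, -, hd⟩ := hder s hs
        exact hd.continuousAt.continuousWithinAt
      · obtain ⟨d, -, hd⟩ := hder s (interior_subset hs)
        exact hd.differentiableAt.differentiableWithinAt
      · obtain ⟨d, hd0, hd⟩ := hder s (interior_subset hs)
        rwa [hd.deriv]
    have h1 := hmono ⟨le_rfl, hℓ⟩ hℓm hℓ
    simp only [add_zero] at h1
    have h2 := h.height_ge
    rw [inner_sub_left] at h2 ⊢
    linarith

/-- Great circles lift through the Gauss map as long as the length bound keeps the lift from the
frontier of `D`. At the supremum `s` of the times that are reached, a subsequence of the points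
converges to some `q₀` in the closure of `D`, where the Gauss map is still a local diffeomorphism;
its local inverse leads from a point near `q₀` past the time `s`. -/
theorem exists_isReached (hF : Manifold.IsSmoothEmbedding (𝓡 n) (𝓡 (n + 1)) ∞ F)
    (hclosed : IsClosed (Set.range F))
    (hν : ContMDiff (𝓡 n) (𝓡 (n + 1)) ∞ ν) (hν1 : ∀ q, ‖ν q‖ = 1)
    (hνperp : ∀ q v, inner ℝ (differential ν q v) (ν q) = 0)
    (hperp : ∀ q v, inner ℝ (differential F q v) (ν q) = 0)
    {D : Set M} (hD : IsOpen D) {p : M} (hp : p ∈ D) (he : ‖e‖ = 1)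
    (hue : inner ℝ (ν p) e = 0) {K k T t₁ : ℝ} (hK0 : 0 ≤ K)
    (hK : ∀ q ∈ D, ∀ v, ‖differential F q v‖ ≤ K * ‖differential ν q v‖)
    (hk : ∀ q ∈ D, ∀ v, k * ‖differential ν q v‖ ^ 2 ≤
      inner ℝ (differential F q v) (differential ν q v))
    (ht₁ : 0 ≤ t₁) (htT : t₁ ≤ T) (hT : T ≤ Real.pi)
    (hfr : ∀ q ∈ frontier D, ENNReal.ofReal (K * t₁) < intrinsicDist F p q) :
    ∃ q, IsReached F ν D p (ν p) e K k T t₁ q := by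
  set A : Set ℝ := {t | t ∈ Set.Icc 0 t₁ ∧ ∃ q, IsReached F ν D p (ν p) e K k T t q} with hA
  have hA0 : (0 : ℝ) ∈ A := ⟨⟨le_rfl, ht₁⟩, p,
    { mem := hp
      normal_eq := by simp [greatCircle]
      dist_le := by simp [intrinsicDist_self]
      norm_le := by simp
      height_ge := by simp }⟩
  have hAbdd : BddAbove A := ⟨t₁, fun t ht => ht.1.2⟩
  set s := sSup A with hs
  have hs0 : 0 ≤ s := le_csSup hAbdd hA0
  have hst₁ : s ≤ t₁ := csSup_le ⟨0, hA0⟩ fun t ht => ht.1.2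
  obtain ⟨τ, -, hτ, hτA⟩ := exists_seq_tendsto_sSup ⟨0, hA0⟩ hAbdd
  choose hτI q hq using hτA
  -- `F` is a closed embedding, so a subsequence of the points `q k` converges in `M`.
  obtain ⟨y, -, ψ, hψ, hy⟩ := (isCompact_closedBall (F p) (K * t₁)).tendsto_subseq
    (x := fun k => F (q k)) fun k => by
      rw [mem_closedBall_iff_norm]
      exact (hq k).norm_le.trans (mul_le_mul_of_nonneg_left (hτI k).2 hK0)
  obtain ⟨q₀, rfl⟩ : y ∈ Set.range F :=
    hclosed.mem_of_tendsto hy (Filter.Eventually.of_forall fun k => ⟨_, rfl⟩)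
  have hq₀ : Filter.Tendsto (q ∘ ψ) Filter.atTop (𝓝 q₀) :=
    hF.isEmbedding.isInducing.tendsto_nhds_iff.2 hy
  have hτψ := hτ.comp hψ.tendsto_atTop
  have hγc : Continuous (greatCircle (ν p) e) := (contDiff_greatCircle _ _).continuous
  have hνq₀ : ν q₀ = greatCircle (ν p) e s := by
    refine tendsto_nhds_unique ((hν.continuous.tendsto q₀).comp hq₀) ?_
    refine ((hγc.tendsto s).comp hτψ).congr fun k => ?_
    exact (hq _).normal_eq.symm
  have hq₀D : q₀ ∈ closure D :=
    mem_closure_of_tendsto hq₀ (Filter.Eventually.of_forall fun k => (hq _).mem)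
  have hinj : Function.Injective (differential ν q₀) := by
    refine (injective_iff_map_eq_zero _).2 fun v hv => ?_
    have h1 := norm_differential_le_of_mem_closure hF.contMDiff hν hK hq₀D v
    rw [hv, norm_zero, mul_zero, norm_le_zero_iff, ← map_zero (differential F q₀)] at h1
    exact differential_injective hF.isImmersion q₀ h1
  obtain ⟨Γ, hΓ, hΓq⟩ := exists_local_inverse_gauss hν hν1 (hνperp q₀) hinj
  -- The great circle stays in the domain of the local inverse `Γ` for times in `(s - δ, s + δ)`.
  rw [hνq₀] at hΓ
  obtain ⟨δ, hδ, hδΓ⟩ := Metric.eventually_nhds_iff.1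
    ((hγc.tendsto s).eventually hΓ.eventually_nhds)
  obtain ⟨k₀, hk₀, hk₀'⟩ := ((hq₀.eventually hΓq).and
    (hτψ.eventually (lt_mem_nhds (show s - δ / 2 < s by linarith)))).exists
  set t := τ (ψ k₀) with ht
  have htA : t ∈ A := ⟨hτI _, _, hq _⟩
  have hts : t ≤ s := le_csSup hAbdd htA
  set t' := min t₁ (s + δ / 4) with ht'
  have hst' : s ≤ t' := le_min hst₁ (by linarith)
  have ht'1 : t' ≤ t₁ := min_le_left _ _
  have ht'2 : t' ≤ s + δ / 4 := min_le_right _ _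
  have hwin : ∀ r ∈ Set.Icc 0 (t' - t), dist (t + r) s < δ := by
    intro r hr
    rw [Real.dist_eq, abs_lt]
    constructor
    · linarith [hr.1, show s - δ / 2 < t from hk₀']
    · linarith [hr.2]
  have hγ1 : ∀ r, ‖greatCircle (ν p) e r‖ = 1 := norm_greatCircle (hν1 p) he hue
  have hreach : IsReached F ν D p (ν p) e K k T t' (Γ (greatCircle (ν p) e (t + (t' - t)))) := by
    have hstart : Γ (greatCircle (ν p) e (t + 0)) = q (ψ k₀) := by
      rw [add_zero, ← (hq (ψ k₀)).normal_eq]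
      exact hk₀
    have hfr' : ∀ q' ∈ frontier D,
        ENNReal.ofReal (K * (t + (t' - t))) < intrinsicDist F p q' := fun q' hq' => by
      rw [add_sub_cancel]
      exact (ENNReal.ofReal_le_ofReal (mul_le_mul_of_nonneg_left ht'1 hK0)).trans_lt (hfr q' hq')
    have h := IsReached.of_lift (c := fun r => Γ (greatCircle (ν p) e (t + r))) (t := t)
      (ℓ := t' - t) hF.contMDiff hν (hν1 p) he hue hD hK0 hK hk hperp htA.1.1 (by linarith)
      (by linarith) hT hfr' ?_ ?_ (by rw [hstart]; exact hq _)
    · have htt' : t + (t' - t) = t' := add_sub_cancel t t'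
      simpa only [htt'] using h
    · intro r hr
      have h1 := (hδΓ (hwin r hr)).self_of_nhds.1
      have h2 : ContMDiffAt 𝓘(ℝ, ℝ) (𝓡 (n + 1)) 1 (fun r => greatCircle (ν p) e (t + r)) r :=
        (((contDiff_greatCircle (ν p) e).comp (contDiff_const.add contDiff_id)).of_le
          (by exact_mod_cast le_top)).contDiffAt.contMDiffAt
      exact h1.comp r h2
    · intro r hr
      have h2 : ContinuousAt (fun r => greatCircle (ν p) e (t + r)) r :=
        (hγc.comp (continuous_const.add continuous_id)).continuousAt
      filter_upwards [h2.eventually (hδΓ (hwin r hr))] with r' hr'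
      exact hr'.2 (hγ1 _)
  have ht'A : t' ∈ A := ⟨⟨hs0.trans hst', ht'1⟩, _, hreach⟩
  have ht's : t' = s := le_antisymm (le_csSup hAbdd ht'A) hst'
  rcases min_choice t₁ (s + δ / 4) with h | h
  · rw [← h]; exact ⟨_, hreach⟩
  · rw [← ht', ht's] at h; linarith

end Continuation

/-! ### The touching ball -/

section Noncollapsing

/-- A time for which unit speed great circles from `ν p` lift through the Gauss map. The lifts have
speed at most `C₀²`, so they have length at most `C₀⁻¹ / 2` and do not reach the frontier of `D`.
The bound by `1` only keeps the time below `π`. -/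
noncomputable def liftTime (C₀ : ℝ) : ℝ := min (1 / 2 * C₀⁻¹ ^ 3) 1

/-- The radius of a ball which touches the hypersurface from inside at every point as in the
theorem; it depends on `C₀` only. -/
noncomputable def rollingRadius (C₀ : ℝ) : ℝ := C₀⁻¹ * ((1 - Real.cos (liftTime C₀)) / 2)

theorem liftTime_pos {C₀ : ℝ} (hC₀ : 0 < C₀) : 0 < liftTime C₀ := by
  unfold liftTime; positivity

theorem rollingRadius_pos {C₀ : ℝ} (hC₀ : 0 < C₀) : 0 < rollingRadius C₀ := by
  have h1 : Real.cos (liftTime C₀) < 1 := by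
    rw [← Real.cos_zero]
    exact Real.cos_lt_cos_of_nonneg_of_le_pi_div_two le_rfl
      ((min_le_right _ _).trans (by linarith [Real.pi_gt_three])) (liftTime_pos hC₀)
  have h2 : 0 < 1 - Real.cos (liftTime C₀) := by linarith
  unfold rollingRadius; positivity

theorem one_sub_cos_le_cos_sub_sub_cos {a b : ℝ} (ha : 0 ≤ a) (hab : a ≤ b) (hb : b ≤ Real.pi) :
    1 - Real.cos a ≤ Real.cos (b - a) - Real.cos b := by
  -- In terms of half angles, the difference of the two sides is `4 cos x sin y sin (x - y)`.
  obtain ⟨x, rfl⟩ : ∃ x, b = 2 * x := ⟨b / 2, by ring⟩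
  obtain ⟨y, rfl⟩ : ∃ y, a = 2 * y := ⟨a / 2, by ring⟩
  have h1 : 0 ≤ Real.cos x * Real.sin y * Real.sin (x - y) := by
    refine mul_nonneg (mul_nonneg (Real.cos_nonneg_of_mem_Icc ⟨?_, ?_⟩)
      (Real.sin_nonneg_of_nonneg_of_le_pi ?_ ?_)) (Real.sin_nonneg_of_nonneg_of_le_pi ?_ ?_) <;>
    linarith [Real.pi_pos]
  rw [Real.sin_sub] at h1
  rw [Real.cos_sub, Real.cos_two_mul x, Real.sin_two_mul, Real.sin_two_mul, Real.cos_two_mul y,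
    Real.cos_sq' y]
  nlinarith

/-- The height gained along the lift of a great circle, which is followed up to the angle `T` or
until `liftTime C₀`, whichever comes first, suffices for the rolling criterion. -/
theorem rollingRadius_mul_le {C₀ T : ℝ} (hC₀ : 0 < C₀) (hT : T ≤ Real.pi) :
    rollingRadius C₀ * (1 - Real.cos T) ≤
      C₀⁻¹ * (Real.cos (T - min T (liftTime C₀)) - Real.cos T) := by
  rw [rollingRadius, mul_assoc]
  refine mul_le_mul_of_nonneg_left ?_ (inv_pos.2 hC₀).le
  have h1 := Real.cos_le_one T
  have h2 := Real.neg_one_le_cos T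
  have h3 := Real.cos_le_one (liftTime C₀)
  have h4 := Real.neg_one_le_cos (liftTime C₀)
  rcases le_total T (liftTime C₀) with h | h
  · rw [min_eq_left h, sub_self, Real.cos_zero]
    nlinarith
  · rw [min_eq_right h]
    have h5 := one_sub_cos_le_cos_sub_sub_cos (liftTime_pos hC₀).le h hT
    nlinarith

variable {n : ℕ} {M : Type*} [TopologicalSpace M] [ChartedSpace (EuclideanSpace ℝ (Fin n)) M]
  {F ν : M → EuclideanSpace ℝ (Fin (n + 1))} {Ω : Set (EuclideanSpace ℝ (Fin (n + 1)))}

/-- The rolling criterion holds at `p`: for `q` in `M`, follow from `ν p` the great circle towards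
`ν q`. The end point `q'` of its lift is already as high in the direction `ν q` as the criterion
asks of `q`, and `q` is at least as high as `q'`, because `q` maximizes the height in the
direction `ν q`. -/
theorem ball_subset_of_pinched [IsManifold (𝓡 n) ∞ M] (hn : 0 < n) {C₀ : ℝ} (hC₀ : 0 < C₀)
    (hF : IsConvexEmbedding F Ω) (hν : IsOutwardUnitNormal F Ω ν) {D : Set M} (hD : IsOpen D)
    (hH : ∀ p ∈ D, C₀⁻¹ ≤ meanCurvature F ν p ∧ meanCurvature F ν p ≤ C₀)
    (hl : ∀ p ∈ D, C₀⁻¹ * meanCurvature F ν p ≤ lambdaOne F ν p) {p : M} (hp : p ∈ D)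
    (hfr : ENNReal.ofReal (1 / 2 * C₀⁻¹) < ⨅ q ∈ frontier D, intrinsicDist F p q) {r : ℝ}
    (hr : r ≤ rollingRadius C₀) : Metric.ball (F p - r • ν p) r ⊆ Ω := by
  have hi : 0 < C₀⁻¹ := inv_pos.2 hC₀
  have hcurv : ∀ q ∈ D, ∀ v, (C₀⁻¹ * C₀⁻¹) * ‖differential F q v‖ ≤ ‖differential ν q v‖ ∧
      ‖differential ν q v‖ ^ 2 ≤ C₀ * inner ℝ (differential F q v) (differential ν q v) :=
    fun q hq => curvature_bounds hF hν (mul_pos hi hi) (hH q hq).2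
      ((mul_le_mul_of_nonneg_left (hH q hq).1 hi.le).trans (hl q hq))
  refine ball_subset_of_forall_inner_ge hF hν fun q => ?_
  -- A unit tangent vector, which gives the direction of the great circle when `ν q = ± ν p`.
  obtain ⟨e₀, he₀, hue₀⟩ : ∃ e₀ : EuclideanSpace ℝ (Fin (n + 1)),
      ‖e₀‖ = 1 ∧ inner ℝ (ν p) e₀ = 0 := by
    set w := differential F p (EuclideanSpace.single ⟨0, hn⟩ (1 : ℝ)) with hw
    have hw0 : w ≠ 0 := by
      rw [hw, Ne, map_eq_zero_iff _ (differential_injective hF.isSmoothEmbedding.isImmersion p)]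
      intro h
      simpa using congrArg norm h
    refine ⟨‖w‖⁻¹ • w, norm_smul_inv_norm hw0, ?_⟩
    rw [inner_smul_right, real_inner_comm, hν.normal, mul_zero]
  obtain ⟨e, he, hue, heq⟩ := exists_greatCircle_eq (hν.norm_eq_one p) (hν.norm_eq_one q) he₀ hue₀
  set T := InnerProductGeometry.angle (ν p) (ν q) with hT
  have hT0 : 0 ≤ T := InnerProductGeometry.angle_nonneg _ _
  have hTpi : T ≤ Real.pi := InnerProductGeometry.angle_le_pi _ _
  have hcos : inner ℝ (ν p) (ν q) = Real.cos T := by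
    rw [← heq, inner_greatCircle (hν.norm_eq_one p) hue]
  obtain ⟨q', hq'⟩ := exists_isReached (K := C₀ ^ 2) (k := C₀⁻¹) (T := T)
    (t₁ := min T (liftTime C₀)) hF.isSmoothEmbedding
    (hF.frontier_eq ▸ isClosed_frontier) hν.contMDiff hν.norm_eq_one
    (inner_differential_normal_self hν) hν.normal hD hp he hue (sq_nonneg C₀)
    (fun q hq v => by
      have h1 := mul_le_mul_of_nonneg_left (hcurv q hq v).1 (sq_nonneg C₀)
      rwa [← mul_assoc, show C₀ ^ 2 * (C₀⁻¹ * C₀⁻¹) = 1 by field_simp, one_mul] at h1)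
    (fun q hq v => by
      rw [inv_mul_le_iff₀ hC₀]
      exact (hcurv q hq v).2)
    (le_min hT0 (liftTime_pos hC₀).le) (min_le_left _ _) hTpi
    (fun q hq => by
      refine lt_of_le_of_lt (ENNReal.ofReal_le_ofReal ?_) (hfr.trans_le (iInf₂_le q hq))
      calc C₀ ^ 2 * min T (liftTime C₀) ≤ C₀ ^ 2 * (1 / 2 * C₀⁻¹ ^ 3) :=
            mul_le_mul_of_nonneg_left ((min_le_right _ _).trans (min_le_left _ _)) (sq_nonneg C₀)
        _ = 1 / 2 * C₀⁻¹ := by field_simp)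
  have h1 := hq'.height_ge
  rw [heq] at h1
  have h2 := inner_sub_normal_nonpos hF hν q q'
  have h3 : F q' - F p = (F q' - F q) + (F q - F p) := by abel
  rw [h3, inner_add_left] at h1
  have h4 := rollingRadius_mul_le hC₀ hTpi
  have h5 := mul_le_mul_of_nonneg_right hr (sub_nonneg.2 (Real.cos_le_one T))
  rw [hcos]
  linarith

theorem div_meanCurvature_le {C₀ H : ℝ} (hC₀ : 0 < C₀) (hH : C₀⁻¹ ≤ H) :
    rollingRadius C₀ * C₀⁻¹ / H ≤ rollingRadius C₀ := by
  rw [div_le_iff₀ ((inv_pos.2 hC₀).trans_le hH)]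
  exact mul_le_mul_of_nonneg_left hH (rollingRadius_pos hC₀).le

end Noncollapsing
end ConvexHypersurface

theorem mainTheorem8 (C₀ : ℝ) (hC₀ : 0 < C₀) :
    (∃ α : ℝ, 0 < α ∧
      ∀ (n : ℕ), 2 ≤ n →
      ∀ (M : Type*) [TopologicalSpace M] [ChartedSpace (EuclideanSpace ℝ (Fin n)) M]
        [IsManifold (𝓡 n) ∞ M] [CompactSpace M]
        (F ν : M → EuclideanSpace ℝ (Fin (n + 1))) (Ω : Set (EuclideanSpace ℝ (Fin (n + 1)))),
        ConvexHypersurface.IsConvexEmbedding F Ω →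
        ConvexHypersurface.IsOutwardUnitNormal F Ω ν →
        (∀ p : M, C₀⁻¹ ≤ ConvexHypersurface.meanCurvature F ν p ∧
          ConvexHypersurface.meanCurvature F ν p ≤ C₀) →
        (∀ p : M, C₀⁻¹ * ConvexHypersurface.meanCurvature F ν p ≤
          ConvexHypersurface.lambdaOne F ν p) →
        ConvexHypersurface.IsNoncollapsed F Ω ν α) ∧
    (∃ α : ℝ, 0 < α ∧
      ∀ (n : ℕ), 2 ≤ n →
      ∀ (M : Type*) [TopologicalSpace M] [ChartedSpace (EuclideanSpace ℝ (Fin n)) M]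
        [IsManifold (𝓡 n) ∞ M]
        (F ν : M → EuclideanSpace ℝ (Fin (n + 1))) (Ω : Set (EuclideanSpace ℝ (Fin (n + 1)))),
        ConvexHypersurface.IsConvexEmbedding F Ω →
        ConvexHypersurface.IsCompleteHypersurface F →
        ConvexHypersurface.IsOutwardUnitNormal F Ω ν →
        ∀ D : Set M, IsOpen D →
        (∀ p ∈ D, C₀⁻¹ ≤ ConvexHypersurface.meanCurvature F ν p ∧
          ConvexHypersurface.meanCurvature F ν p ≤ C₀) →
        (∀ p ∈ D, C₀⁻¹ * ConvexHypersurface.meanCurvature F ν p ≤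
          ConvexHypersurface.lambdaOne F ν p) →
        ∀ p ∈ D,
          ENNReal.ofReal (1 / 2 * C₀⁻¹) <
            (⨅ q ∈ frontier D, ConvexHypersurface.intrinsicDist F p q) →
          ENNReal.ofReal (α / ConvexHypersurface.meanCurvature F ν p) ≤
            ConvexHypersurface.inscribedRadius F Ω ν p) := by

  have hα : 0 < ConvexHypersurface.rollingRadius C₀ * C₀⁻¹ :=
    mul_pos (ConvexHypersurface.rollingRadius_pos hC₀) (inv_pos.2 hC₀)
  refine ⟨⟨_, hα, ?_⟩, ⟨_, hα, ?_⟩⟩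
  · intro n hn M _ _ _ _ F ν Ω hF hν hH hl p
    -- Take `D = M`: its frontier is empty, so the distance to it is `⊤`.
    have hfr : ENNReal.ofReal (1 / 2 * C₀⁻¹) <
        ⨅ q ∈ frontier (Set.univ : Set M), ConvexHypersurface.intrinsicDist F p q := by
      simp only [frontier_univ, Set.mem_empty_iff_false, iInf_false, iInf_top]
      exact ENNReal.ofReal_lt_top
    exact ConvexHypersurface.ball_subset_of_pinched (by omega) hC₀ hF hν isOpen_univ
      (fun q _ => hH q) (fun q _ => hl q) (Set.mem_univ p) hfr
      (ConvexHypersurface.div_meanCurvature_le hC₀ (hH p).1)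
  · intro n hn M _ _ _ F ν Ω hF _ hν D hD hH hl p hp hfr
    have hHp : 0 < ConvexHypersurface.meanCurvature F ν p := (inv_pos.2 hC₀).trans_le (hH p hp).1
    refine le_iSup₂_of_le (Real.toNNReal (_ / ConvexHypersurface.meanCurvature F ν p)) ?_ le_rfl
    rw [Real.coe_toNNReal _ (div_pos hα hHp).le]
    exact ConvexHypersurface.ball_subset_of_pinched (by omega) hC₀ hF hν hD hH hl hp hfr
      (ConvexHypersurface.div_meanCurvature_le hC₀ (hH p hp).1)
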